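/- Let $(\Omega,\mu)$ be a measure space, $\mathbb K\in\{\mathbb R,\mathbb C\}$, and let $T$ be a positive $C_0$-semigroup on $L_1(\mu)=L_1(\mu;\mathbb K)$ with generator $A$. Let $M\ge 1$ and $\omega\in\mathbb R$ be such that $\|T(t)\|_{1\to1}\le Me^{\omega t}$ for all $t\ge 0$. For a measurable function $W\colon\Omega\to\mathbb R$ and $n\in\mathbb N$ put $W_n:=(W\wedge n)\vee(-n)$, and let $T_{W_n}$ be the $C_0$-semigroup generated by $A-W_n$, where $W_n$ acts as a bounded multiplication operator. If for every $t\ge 0$ the strong limit $T_W(t):=\lim_{n\to\infty}T_{W_n}(t)$ exists in $\mathcal L(L_1(\mu))$ and $T_W$ is a $C_0$-semigroup, then we say that $T_W$ exists as a $C_0$-semigroup. A measurable function $V\colon\Omega\to\mathbb R$ is called $T$-admissible if, with $V^+=V\vee 0$ and $-V^-=V\wedge 0$, both $T_{V^+}$ and $T_{-V^-}$ exist as $C_0$-semigroups. Let $V\colon\Omega\to\mathbb R$ be measurable, and assume that there are $\lambda>\omega$ and $\alpha\in(0,1)$ such that $$\|V(\lambda-A)^{-1}\|_{1\to1}:=\sup\{\|V(\lambda-A)^{-1}f\|_1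 : f\in L_1(\mu),\ \|f\|_1\le 1\}\le\alpha .$$ (Here $\|g\|_1=\infty$ for measurable $g\notin L_1(\mu)$.) Then $V$ is $T$-admissible, $T_V$ exists as a $C_0$-semigroup, and $$\|T_V(t)\|_{1\to1}\le\frac{M}{1-\alpha}\,e^{\lambda t}\qquad(t\ge 0).$$ -/

import Mathlib

open MeasureTheory Filter Topology
open scoped NNReal ENNReal

noncomputable section

/-- A `C₀`-semigroup of bounded linear operators: a strongly continuous one-parameter semigroup. -/
structure IsC0Semigroup {𝕜 X : Type*} [RCLike 𝕜] [NormedAddCommGroup X] [NormedSpace 𝕜 X]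
    (T : ℝ≥0 → X →L[𝕜] X) : Prop where
  map_zero : T 0 = ContinuousLinearMap.id 𝕜 X
  map_add : ∀ s t, T (s + t) = (T s).comp (T t)
  continuous : ∀ f, Continuous fun t => T t f

/-- `g` is the right derivative at `0` of the orbit `t ↦ T t f`. -/
def HasOrbitDeriv {𝕜 X : Type*} [RCLike 𝕜] [NormedAddCommGroup X] [NormedSpace 𝕜 X]
    (T : ℝ≥0 → X →L[𝕜] X) (f g : X) : Prop :=
  Tendsto (fun t : ℝ≥0 => ((t : ℝ) : 𝕜)⁻¹ • (T t f - f)) (𝓝[>] 0) (𝓝 g)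

theorem HasOrbitDeriv.add {𝕜 X : Type*} [RCLike 𝕜] [NormedAddCommGroup X] [NormedSpace 𝕜 X]
    {T : ℝ≥0 → X →L[𝕜] X} {f g f' g' : X} (h : HasOrbitDeriv T f g) (h' : HasOrbitDeriv T f' g') :
    HasOrbitDeriv T (f + f') (g + g') := by
  refine (Tendsto.add h h').congr fun t => ?_
  rw [← smul_add, _root_.map_add]
  congr 1
  abel

theorem HasOrbitDeriv.smul {𝕜 X : Type*} [RCLike 𝕜] [NormedAddCommGroup X] [NormedSpace 𝕜 X]
    {T : ℝ≥0 → X →L[𝕜] X} {f g : X} (c : 𝕜) (h : HasOrbitDeriv T f g) :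
    HasOrbitDeriv T (c • f) (c • g) := by
  refine (Tendsto.const_smul h c).congr fun t => ?_
  rw [map_smul, ← smul_sub, smul_comm]

theorem HasOrbitDeriv.zero {𝕜 X : Type*} [RCLike 𝕜] [NormedAddCommGroup X] [NormedSpace 𝕜 X]
    (T : ℝ≥0 → X →L[𝕜] X) : HasOrbitDeriv T 0 0 := by
  simp [HasOrbitDeriv]

theorem HasOrbitDeriv.unique {𝕜 X : Type*} [RCLike 𝕜] [NormedAddCommGroup X] [NormedSpace 𝕜 X]
    {T : ℝ≥0 → X →L[𝕜] X} {f g g' : X} (h : HasOrbitDeriv T f g) (h' : HasOrbitDeriv T f g') :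
    g = g' :=
  tendsto_nhds_unique h h'

/-- The generator `A` of `T`, an unbounded operator: its domain consists of all `f` for which
`A f = lim_{t → 0+} t⁻¹ (T t f - f)` exists. -/
def semigroupGenerator {𝕜 X : Type*} [RCLike 𝕜] [NormedAddCommGroup X] [NormedSpace 𝕜 X]
    (T : ℝ≥0 → X →L[𝕜] X) : X →ₗ.[𝕜] X where
  domain :=
    { carrier := {f | ∃ g, HasOrbitDeriv T f g}
      add_mem' := fun ⟨_, h⟩ ⟨_, h'⟩ => ⟨_, h.add h'⟩
      zero_mem' := ⟨0, HasOrbitDeriv.zero T⟩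
      smul_mem' := fun c _ ⟨_, h⟩ => ⟨_, h.smul c⟩ }
  toFun :=
    { toFun := fun f => f.2.choose
      map_add' := fun f f' =>
        (f + f').2.choose_spec.unique (f.2.choose_spec.add f'.2.choose_spec)
      map_smul' := fun c f => (c • f).2.choose_spec.unique (f.2.choose_spec.smul c) }

/-- The operator `(z - A)⁻¹`, defined on the range of `z - A`. -/
def resolventOperator {𝕜 X : Type*} [RCLike 𝕜] [NormedAddCommGroup X] [NormedSpace 𝕜 X]
    (A : X →ₗ.[𝕜] X) (z : 𝕜) : X →ₗ.[𝕜] X :=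
  ((z • (LinearMap.id : X →ₗ[𝕜] X)).toPMap ⊤ - A).inverse

/-- A bounded operator on `L₁(μ)` is positive if it maps nonnegative functions to nonnegative
functions. -/
def IsPositiveOperator {Ω 𝕜 : Type*} [MeasurableSpace Ω] [RCLike 𝕜] {μ : Measure Ω}
    (S : Lp 𝕜 1 μ →L[𝕜] Lp 𝕜 1 μ) : Prop :=
  ∀ f : Lp 𝕜 1 μ, (∀ᵐ x ∂μ, 0 ≤ RCLike.re (f x) ∧ RCLike.im (f x) = 0) →
    ∀ᵐ x ∂μ, 0 ≤ RCLike.re (S f x) ∧ RCLike.im (S f x) = 0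

theorem mul_coeFn_add_ae {Ω 𝕜 : Type*} [MeasurableSpace Ω] [RCLike 𝕜] {μ : Measure Ω}
    (V : Ω → ℝ) (f g : Lp 𝕜 1 μ) :
    (fun x => (V x : 𝕜) * (f + g : Lp 𝕜 1 μ) x) =ᵐ[μ]
      (fun x => (V x : 𝕜) * f x) + fun x => (V x : 𝕜) * g x := by
  filter_upwards [Lp.coeFn_add f g] with x hx
  rw [hx, Pi.add_apply, Pi.add_apply, mul_add]

theorem mul_coeFn_smul_ae {Ω 𝕜 : Type*} [MeasurableSpace Ω] [RCLike 𝕜] {μ : Measure Ω}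
    (V : Ω → ℝ) (c : 𝕜) (f : Lp 𝕜 1 μ) :
    (fun x => (V x : 𝕜) * (c • f : Lp 𝕜 1 μ) x) =ᵐ[μ] c • fun x => (V x : 𝕜) * f x := by
  filter_upwards [Lp.coeFn_smul c f] with x hx
  rw [hx, Pi.smul_apply, Pi.smul_apply, smul_eq_mul, smul_eq_mul, mul_left_comm]

theorem mul_coeFn_zero_ae {Ω 𝕜 : Type*} [MeasurableSpace Ω] [RCLike 𝕜] {μ : Measure Ω}
    (V : Ω → ℝ) : (fun x => (V x : 𝕜) * (0 : Lp 𝕜 1 μ) x) =ᵐ[μ] (0 : Ω → 𝕜) := by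
  filter_upwards [Lp.coeFn_zero 𝕜 1 μ] with x hx
  rw [hx, Pi.zero_apply, mul_zero]

/-- The maximal domain `{f ∈ L₁(μ) | V f ∈ L₁(μ)}` of multiplication by `V`. -/
def multiplicationDomain {Ω : Type*} (𝕜 : Type*) [MeasurableSpace Ω] [RCLike 𝕜] (μ : Measure Ω)
    (V : Ω → ℝ) : Submodule 𝕜 (Lp 𝕜 1 μ) where
  carrier := {f | MemLp (fun x => (V x : 𝕜) * f x) 1 μ}
  add_mem' := fun {f g} hf hg => (memLp_congr_ae (mul_coeFn_add_ae V f g)).2 (MemLp.add hf hg)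
  zero_mem' := (memLp_congr_ae (mul_coeFn_zero_ae V)).2 MemLp.zero
  smul_mem' := fun c f hf => (memLp_congr_ae (mul_coeFn_smul_ae V c f)).2 (MemLp.const_smul hf c)

theorem memLp_of_mem_multiplicationDomain {Ω 𝕜 : Type*} [MeasurableSpace Ω] [RCLike 𝕜]
    {μ : Measure Ω} {V : Ω → ℝ} {f : Lp 𝕜 1 μ} (hf : f ∈ multiplicationDomain 𝕜 μ V) :
    MemLp (fun x => (V x : 𝕜) * f x) 1 μ :=
  hf

/-- The operator on `L₁(μ)` of multiplication by `V`, with its maximal domain. -/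
def multiplicationOperator {Ω : Type*} (𝕜 : Type*) [MeasurableSpace Ω] [RCLike 𝕜] (μ : Measure Ω)
    (V : Ω → ℝ) : Lp 𝕜 1 μ →ₗ.[𝕜] Lp 𝕜 1 μ where
  domain := multiplicationDomain 𝕜 μ V
  toFun :=
    { toFun := fun f => (memLp_of_mem_multiplicationDomain f.2).toLp
      map_add' := fun f g => by
        rw [← MemLp.toLp_add, MemLp.toLp_eq_toLp_iff]
        exact mul_coeFn_add_ae V _ _
      map_smul' := fun c f => by
        rw [RingHom.id_apply, ← MemLp.toLp_const_smul, MemLp.toLp_eq_toLp_iff]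
        exact mul_coeFn_smul_ae V c _ }

/-- The norm `‖V B‖_{1 → 1} ∈ [0, ∞]`, the supremum of `‖V B f‖₁` over all `f` with `‖f‖₁ ≤ 1`;
here `‖V B f‖₁ = ∞` if `V B f` is not in `L₁(μ)`. -/
def mulCompNorm {Ω 𝕜 : Type*} [MeasurableSpace Ω] [RCLike 𝕜] {μ : Measure Ω}
    (V : Ω → ℝ) (B : Lp 𝕜 1 μ →ₗ.[𝕜] Lp 𝕜 1 μ) : ℝ≥0∞ :=
  ⨆ (f : B.domain) (_ : ‖(f : Lp 𝕜 1 μ)‖ ≤ 1), eLpNorm (fun x => (V x : 𝕜) * B f x) 1 μ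

/-- The truncation `(V ∧ n) ∨ (-n)`. -/
def truncation {Ω : Type*} (V : Ω → ℝ) (n : ℕ) : Ω → ℝ :=
  fun x => max (min (V x) n) (-n)

/-- For bounded `V`, with `A` the generator of `T`: `S` is the `C₀`-semigroup generated
by `A - V`. -/
def IsBoundedPerturbation {Ω 𝕜 : Type*} [MeasurableSpace Ω] [RCLike 𝕜] {μ : Measure Ω}
    (T : ℝ≥0 → Lp 𝕜 1 μ →L[𝕜] Lp 𝕜 1 μ) (V : Ω → ℝ)
    (S : ℝ≥0 → Lp 𝕜 1 μ →L[𝕜] Lp 𝕜 1 μ) : Prop :=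
  IsC0Semigroup S ∧ semigroupGenerator S = semigroupGenerator T - multiplicationOperator 𝕜 μ V

/-- `S = T_V`: the operators `S t` are the strong limits of `T_{(V ∧ n) ∨ (-n)} t` as `n → ∞`,
and they form a `C₀`-semigroup. -/
def IsAbsorptionSemigroup {Ω 𝕜 : Type*} [MeasurableSpace Ω] [RCLike 𝕜] {μ : Measure Ω}
    (T : ℝ≥0 → Lp 𝕜 1 μ →L[𝕜] Lp 𝕜 1 μ) (V : Ω → ℝ)
    (S : ℝ≥0 → Lp 𝕜 1 μ →L[𝕜] Lp 𝕜 1 μ) : Prop :=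
  IsC0Semigroup S ∧ ∃ U : ℕ → ℝ≥0 → Lp 𝕜 1 μ →L[𝕜] Lp 𝕜 1 μ,
    (∀ n, IsBoundedPerturbation T (truncation V n) (U n)) ∧
    ∀ t f, Tendsto (fun n => U n t f) atTop (𝓝 (S t f))

/-- `V` is `T`-admissible: `T_{V⁺}` and `T_{-V⁻}` exist and are `C₀`-semigroups.
(The truncation of `V⁺` is `V⁺ ∧ n`, and that of `-V⁻` is `(-V⁻) ∨ (-n)`.) -/
def IsAdmissible {Ω 𝕜 : Type*} [MeasurableSpace Ω] [RCLike 𝕜] {μ : Measure Ω}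
    (T : ℝ≥0 → Lp 𝕜 1 μ →L[𝕜] Lp 𝕜 1 μ) (V : Ω → ℝ) : Prop :=
  (∃ S, IsAbsorptionSemigroup T (fun x => max (V x) 0) S) ∧
  (∃ S, IsAbsorptionSemigroup T (fun x => min (V x) 0) S)

end

/-! ### Strongly continuous semigroups: joint continuity, rescaling, orbit derivatives. -/

section Semigroup

/-! The resolvent bound is turned into Miyadera's condition `∫₀ᵗ e^{-λs} ‖W T(s) f‖ ds ≤ α ‖f‖` for
every bounded measurable `W` with `|W| ≤ |V|`. Positivity gives `|T(s) f| ≤ T(s)|f|`, and the `L₁`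
norm is additive on the positive cone, so the integral is at most `‖W F‖` with `F = ∫₀^τ e^{-λs}
T(s)|f| ds`, for any `τ ≥ t`. Here `F = (λ - A)⁻¹(|f| - e^{-λτ} T(τ)|f|)`, so the hypothesis bounds
`‖V F‖` by `α (1 + M e^{(ω-λ)τ}) ‖f‖`; now let `τ → ∞`. This is `miyaderaIntegral_mulCLM_le`
combined with `exists_resolventOperator_eq_integral`.

The truncations give bounded perturbations `S n` of `T`, obtained from the variation of constants
formula (`exists_solvesDuhamel`). In the form `S(t) f = T(t) f + ∫₀ᵗ S(t-s) B T(s) f ds`, the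
Miyadera condition makes the right side contract in `S` with factor `α`, relative to the weight
`e^{λt}`. Iterating it yields the bound `M/(1-α)`, the fixed point of `c ↦ M + α c`
(`norm_le_of_miyaderaIntegral_le`). Iterating it for differences `S n - S m` yields local uniform
convergence (`exists_norm_sub_le`), because the Miyadera integrals of the differences of truncations
tend to zero by dominated convergence.

Only `|W| ≤ |V|` matters, so the argument covers `V`, `V⁺` and `-V⁻` at once. -/

theorem tendsto_sub_const_nhdsGT (s : ℝ) : Tendsto (fun x : ℝ => x - s) (𝓝[>] s) (𝓝[>] 0) := by
  refine tendsto_nhdsWithin_iff.2 ⟨?_, ?_⟩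
  · have : Tendsto (fun x : ℝ => x - s) (𝓝 s) (𝓝 (s - s)) := tendsto_id.sub_const s
    rw [sub_self] at this
    exact this.mono_left nhdsWithin_le_nhds
  · filter_upwards [self_mem_nhdsWithin] with x hx
    simpa using hx

theorem tendsto_coe_nhdsGT_zero : Tendsto ((↑) : ℝ≥0 → ℝ) (𝓝[>] 0) (𝓝[>] 0) := by
  refine tendsto_nhdsWithin_iff.2 ⟨?_, ?_⟩
  · simpa using (NNReal.continuous_coe.tendsto 0).mono_left nhdsWithin_le_nhds
  · filter_upwards [self_mem_nhdsWithin] with x hx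
    simpa using hx

variable {𝕜 X : Type*} [RCLike 𝕜] [NormedAddCommGroup X] [NormedSpace 𝕜 X]

/-- The exponential bound makes the operators locally equicontinuous in time, which upgrades strong
continuity to joint continuity in time and vector. -/
theorem IsC0Semigroup.tendsto_apply {T : ℝ≥0 → X →L[𝕜] X} (hT : IsC0Semigroup T) {M ω : ℝ}
    (hb : ∀ t : ℝ≥0, ‖T t‖ ≤ M * Real.exp (ω * t)) {ι : Type*} {l : Filter ι} {a : ι → ℝ≥0}
    {u : ι → X} {a₀ : ℝ≥0} {u₀ : X} (ha : Tendsto a l (𝓝 a₀)) (hu : Tendsto u l (𝓝 u₀)) :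
    Tendsto (fun i => T (a i) (u i)) l (𝓝 (T a₀ u₀)) := by
  have h1 : Tendsto (fun i => T (a i) u₀) l (𝓝 (T a₀ u₀)) :=
    ((hT.continuous u₀).tendsto a₀).comp ha
  have h2 : Tendsto (fun i => T (a i) (u i - u₀)) l (𝓝 0) := by
    have h3 : Tendsto (fun i => M * Real.exp (ω * a i) * ‖u i - u₀‖) l
        (𝓝 (M * Real.exp (ω * a₀) * ‖u₀ - u₀‖)) := by
      have h4 : Tendsto (fun i => ((a i : ℝ≥0) : ℝ)) l (𝓝 (a₀ : ℝ)) :=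
        (NNReal.continuous_coe.tendsto a₀).comp ha
      exact (tendsto_const_nhds.mul ((Real.continuous_exp.tendsto _).comp
        (tendsto_const_nhds.mul h4))).mul (hu.sub_const u₀).norm
    rw [sub_self, norm_zero, mul_zero] at h3
    exact squeeze_zero_norm (fun i => ((T (a i)).le_opNorm _).trans
      (mul_le_mul_of_nonneg_right (hb _) (norm_nonneg _))) h3
  simpa using h2.add h1

theorem IsC0Semigroup.continuous_apply {T : ℝ≥0 → X →L[𝕜] X} (hT : IsC0Semigroup T) {M ω : ℝ}
    (hb : ∀ t : ℝ≥0, ‖T t‖ ≤ M * Real.exp (ω * t)) {Y : Type*} [TopologicalSpace Y] {a : Y → ℝ≥0}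
    {u : Y → X} (ha : Continuous a) (hu : Continuous u) : Continuous fun y => T (a y) (u y) :=
  continuous_iff_continuousAt.2 fun y => hT.tendsto_apply hb (ha.tendsto y) (hu.tendsto y)

theorem IsC0Semigroup.add_apply {T : ℝ≥0 → X →L[𝕜] X} (hT : IsC0Semigroup T) (s t : ℝ≥0) (f : X) :
    T (s + t) f = T s (T t f) := by
  rw [hT.map_add, ContinuousLinearMap.comp_apply]

theorem IsC0Semigroup.zero_apply {T : ℝ≥0 → X →L[𝕜] X} (hT : IsC0Semigroup T) (f : X) :
    T 0 f = f := by
  rw [hT.map_zero, ContinuousLinearMap.id_apply]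

theorem nonneg_of_norm_le_mul_exp {T : ℝ≥0 → X →L[𝕜] X} {M ω : ℝ}
    (hb : ∀ t : ℝ≥0, ‖T t‖ ≤ M * Real.exp (ω * t)) : 0 ≤ M := by
  simpa using (norm_nonneg _).trans (hb 0)

theorem IsC0Semigroup.exp_smul {T : ℝ≥0 → X →L[𝕜] X} (hT : IsC0Semigroup T) (κ : ℝ) :
    IsC0Semigroup fun t : ℝ≥0 => ((Real.exp (κ * t) : ℝ) : 𝕜) • T t where
  map_zero := by simp [hT.map_zero]
  map_add s t := by
    ext f
    simp only [_root_.smul_apply, ContinuousLinearMap.comp_apply, map_smul,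
      hT.add_apply, smul_smul]
    rw [NNReal.coe_add, mul_add, Real.exp_add]
    push_cast
    rw [mul_comm]
  continuous f := by
    refine Continuous.smul (RCLike.continuous_ofReal.comp ?_) (hT.continuous f)
    fun_prop

theorem norm_exp_smul (κ : ℝ) (t : ℝ≥0) (B : X →L[𝕜] X) :
    ‖((Real.exp (κ * t) : ℝ) : 𝕜) • B‖ = Real.exp (κ * t) * ‖B‖ := by
  rw [norm_smul, RCLike.norm_ofReal, abs_of_pos (Real.exp_pos _)]

theorem hasOrbitDeriv_iff [NormedSpace ℝ X] [IsScalarTower ℝ 𝕜 X] {T : ℝ≥0 → X →L[𝕜] X}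
    (hT : IsC0Semigroup T) {f g : X} :
    HasOrbitDeriv T f g ↔
      HasDerivWithinAt (fun t : ℝ => T t.toNNReal f) g (Set.Ioi 0) 0 := by
  rw [hasDerivWithinAt_iff_tendsto_slope' (by simp), HasOrbitDeriv]
  have key : ∀ t : ℝ≥0, ((t : ℝ) : 𝕜)⁻¹ • (T t f - f) =
      slope (fun t : ℝ => T t.toNNReal f) 0 (t : ℝ) := fun t => by
    rw [slope_def_module, sub_zero, Real.toNNReal_coe, Real.toNNReal_zero, hT.zero_apply,
      ← RCLike.ofReal_inv, ← RCLike.real_smul_eq_coe_smul]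
  have h1 : Tendsto Real.toNNReal (𝓝[>] 0) (𝓝[>] 0) := by
    refine tendsto_nhdsWithin_iff.2 ⟨?_, ?_⟩
    · simpa using (continuous_real_toNNReal.tendsto 0).mono_left nhdsWithin_le_nhds
    · filter_upwards [self_mem_nhdsWithin] with x hx
      simpa using hx
  constructor
  · intro h
    refine (h.comp h1).congr' ?_
    filter_upwards [self_mem_nhdsWithin] with x hx
    rw [Function.comp_apply, key, Real.coe_toNNReal x (le_of_lt hx)]
  · intro h
    exact (h.comp tendsto_coe_nhdsGT_zero).congr fun t => (key t).symm

end Semigroup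

/-! ### Bounded perturbations and the variation of constants formula. -/

section Perturbation

variable {𝕜 X : Type*} [RCLike 𝕜] [NormedAddCommGroup X] [NormedSpace 𝕜 X] [NormedSpace ℝ X]

/-- `S` solves the variation of constants formula for the perturbation of `T` by `B`. -/
def SolvesDuhamel (T : ℝ≥0 → X →L[𝕜] X) (B : X →L[𝕜] X) (S : ℝ≥0 → X →L[𝕜] X) : Prop :=
  ∀ (t : ℝ≥0) (f : X),
    S t f = T t f + ∫ s in (0 : ℝ)..t, T (t - s.toNNReal) (B (S s.toNNReal f))

theorem integral_exp_neg_mul_sub_le {β : ℝ} (hβ : 0 < β) (t : ℝ) :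
    ∫ s in (0 : ℝ)..t, Real.exp (-β * (t - s)) ≤ β⁻¹ := by
  have h : ∀ s ∈ Set.uIcc 0 t, HasDerivAt (fun s => β⁻¹ * Real.exp (-β * (t - s)))
      (Real.exp (-β * (t - s))) s := fun s _ => by
    have h1 : HasDerivAt (fun s : ℝ => -β * (t - s)) (-β * (-1)) s :=
      ((hasDerivAt_id s).const_sub t).const_mul _
    refine (h1.exp.const_mul β⁻¹).congr_deriv ?_
    field_simp
  rw [intervalIntegral.integral_eq_sub_of_hasDerivAt h
    (Continuous.intervalIntegrable (by fun_prop) _ _)]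
  have : 0 < Real.exp (-β * (t - 0)) := Real.exp_pos _
  have := mul_pos (inv_pos.2 hβ) this
  simp only [sub_self, mul_zero, Real.exp_zero, mul_one]
  linarith

variable [CompleteSpace X]

/-- The Duhamel integrand is jointly continuous in `(t, s)` with value `B f` at the origin, so its
mean over `[0, t]` tends to `B f`. No domain condition on `f` is needed; hence both generators have
the same domain and differ by `B`. -/
theorem SolvesDuhamel.tendsto_slope {T S : ℝ≥0 → X →L[𝕜] X} {B : X →L[𝕜] X}
    (h : SolvesDuhamel T B S) (hT : IsC0Semigroup T) (hS : IsC0Semigroup S) {M ω : ℝ}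
    (hb : ∀ t : ℝ≥0, ‖T t‖ ≤ M * Real.exp (ω * t)) (f : X) :
    HasDerivWithinAt (fun t : ℝ => S t.toNNReal f - T t.toNNReal f) (B f) (Set.Ioi 0) 0 := by
  have hc : Continuous fun p : ℝ × ℝ =>
      T (p.1.toNNReal - p.2.toNNReal) (B (S p.2.toNNReal f)) := by
    refine hT.continuous_apply hb (by fun_prop) (B.continuous.comp ((hS.continuous f).comp ?_))
    fun_prop
  rw [hasDerivWithinAt_iff_isLittleO, Asymptotics.isLittleO_iff]
  intro ε hε
  have h0 := hc.tendsto (0, 0)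
  simp only [Real.toNNReal_zero, tsub_zero, hS.zero_apply, hT.zero_apply] at h0
  obtain ⟨δ, hδ, hd⟩ := Metric.eventually_nhds_iff.1 (Metric.tendsto_nhds.1 h0 ε hε)
  filter_upwards [inter_mem_nhdsWithin (Set.Ioi (0 : ℝ)) (Metric.ball_mem_nhds 0 hδ)] with t ht
  have ht0 : 0 < t := ht.1
  have htδ : t < δ := by simpa [abs_of_pos ht0] using ht.2
  have heq : S t.toNNReal f - T t.toNNReal f - (S (0 : ℝ).toNNReal f - T (0 : ℝ).toNNReal f)
      - (t - 0) • B f =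
      ∫ s in (0 : ℝ)..t, (T (t.toNNReal - s.toNNReal) (B (S s.toNNReal f)) - B f) := by
    rw [intervalIntegral.integral_sub, intervalIntegral.integral_const, h t.toNNReal f,
      Real.coe_toNNReal t ht0.le, Real.toNNReal_zero, hS.zero_apply, hT.zero_apply]
    · simp
    · exact (hc.comp (by fun_prop : Continuous fun s : ℝ => (t, s))).intervalIntegrable 0 t
    · exact intervalIntegrable_const
  rw [heq]
  refine (intervalIntegral.norm_integral_le_of_norm_le_const (C := ε) fun s hs => ?_).trans_eq
    (by rw [Real.norm_eq_abs])
  rw [Set.uIoc_of_le ht0.le] at hs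
  rw [← dist_eq_norm]
  refine (hd (y := (t, s)) ?_).le
  rw [Prod.dist_eq]
  simp only [Real.dist_eq, sub_zero, abs_of_pos ht0, abs_of_pos hs.1]
  exact max_lt htδ (hs.2.trans_lt htδ)

variable [IsScalarTower ℝ 𝕜 X]

theorem SolvesDuhamel.hasOrbitDeriv_iff {T S : ℝ≥0 → X →L[𝕜] X} {B : X →L[𝕜] X}
    (h : SolvesDuhamel T B S) (hT : IsC0Semigroup T) (hS : IsC0Semigroup S) {M ω : ℝ}
    (hb : ∀ t : ℝ≥0, ‖T t‖ ≤ M * Real.exp (ω * t)) {f g : X} :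
    HasOrbitDeriv S f (g + B f) ↔ HasOrbitDeriv T f g := by
  rw [_root_.hasOrbitDeriv_iff hS, _root_.hasOrbitDeriv_iff hT]
  have hd := h.tendsto_slope hT hS hb f
  constructor
  · intro h1
    simpa [Pi.sub_def] using h1.sub hd
  · intro h1
    simpa [Pi.add_def] using h1.add hd

/-- The variation of constants formula with the roles of the two semigroups interchanged. -/
theorem SolvesDuhamel.eq_add_integral {T S : ℝ≥0 → X →L[𝕜] X} {B : X →L[𝕜] X}
    (h : SolvesDuhamel T B S) (hT : IsC0Semigroup T) (hS : IsC0Semigroup S) {M ω M' ω' : ℝ}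
    (hb : ∀ t : ℝ≥0, ‖T t‖ ≤ M * Real.exp (ω * t))
    (hb' : ∀ t : ℝ≥0, ‖S t‖ ≤ M' * Real.exp (ω' * t)) (t : ℝ≥0) (f : X) :
    S t f = T t f + ∫ s in (0 : ℝ)..t, S (t - s.toNNReal) (B (T s.toNNReal f)) := by
  have hc1 : Continuous fun s : ℝ => T s.toNNReal f := (hT.continuous f).comp (by fun_prop)
  have hc : Continuous fun s : ℝ => S (t - s.toNNReal) (T s.toNNReal f) :=
    hS.continuous_apply hb' (by fun_prop) hc1
  have hc' : Continuous fun s : ℝ => -S (t - s.toNNReal) (B (T s.toNNReal f)) :=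
    (hS.continuous_apply hb' (by fun_prop) (B.continuous.comp hc1)).neg
  -- Integrate the right derivative of `s ↦ S(t-s) T(s) f`. Its increment from `s` to `s + h` is
  -- `-S(t-s-h) (S(h) - T(h)) T(s) f`, so only `S - T` is differentiated and `f` may be arbitrary.
  have key := intervalIntegral.integral_eq_sub_of_hasDeriv_right_of_le t.2 hc.continuousOn
    (f' := fun s : ℝ => -S (t - s.toNNReal) (B (T s.toNNReal f))) ?_ (hc'.intervalIntegrable _ _)
  · rw [intervalIntegral.integral_neg] at key
    simp only [NNReal.val_eq_coe, Real.toNNReal_coe, tsub_self, Real.toNNReal_zero, tsub_zero, hS.zero_apply,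
      hT.zero_apply] at key
    rw [neg_eq_iff_eq_neg, neg_sub] at key
    rw [key]
    abel
  · intro s hs
    have hd := h.tendsto_slope hT hS hb (T s.toNNReal f)
    rw [hasDerivWithinAt_iff_tendsto_slope' (by simp)] at hd ⊢
    have ha : Tendsto (fun x : ℝ => t - x.toNNReal) (𝓝[>] s) (𝓝 (t - s.toNNReal)) :=
      ((by fun_prop : Continuous fun x : ℝ => t - x.toNNReal).tendsto s).mono_left
        nhdsWithin_le_nhds
    have := hS.tendsto_apply hb' ha (hd.comp (tendsto_sub_const_nhdsGT s)).neg
    simp only [map_neg] at this ⊢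
    refine this.congr' ?_
    filter_upwards [Ioo_mem_nhdsGT hs.2] with x hx
    have hxs : 0 ≤ x - s := (sub_pos.2 hx.1).le
    have e1 : x.toNNReal = (x - s).toNNReal + s.toNNReal := by
      rw [← Real.toNNReal_add hxs hs.1.le, sub_add_cancel]
    have e2 : t - s.toNNReal = (t - x.toNNReal) + (x - s).toNNReal := by
      apply NNReal.eq
      rw [NNReal.coe_add, NNReal.coe_sub (Real.toNNReal_le_iff_le_coe.2 hs.2.le),
        NNReal.coe_sub (Real.toNNReal_le_iff_le_coe.2 hx.2.le), Real.coe_toNNReal _ hxs,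
        Real.coe_toNNReal _ hs.1.le, Real.coe_toNNReal _ (hs.1.le.trans hx.1.le)]
      ring
    simp only [Function.comp_apply, slope_def_module, sub_zero, Real.toNNReal_zero,
      hS.zero_apply, hT.zero_apply, sub_self]
    rw [e2, hS.add_apply, ← map_sub, e1, hT.add_apply, ← e1,
      RCLike.real_smul_eq_coe_smul (K := 𝕜), RCLike.real_smul_eq_coe_smul (K := 𝕜), ← map_neg,
      ← smul_neg, map_smul, neg_sub]

/-- The condition on `β` makes the Volterra operator `K` have norm at most `M ‖B‖ / β ≤ 1/2` on
bounded continuous functions, so `1 - K` is invertible and the orbits of `S` are `(1 - K)⁻¹` applied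
to the orbits of `T`. -/
theorem exists_solvesDuhamel_of_decay {T : ℝ≥0 → X →L[𝕜] X} (hT : IsC0Semigroup T) {M β : ℝ}
    (hβ : 0 < β) (hb : ∀ t : ℝ≥0, ‖T t‖ ≤ M * Real.exp (-β * t)) (B : X →L[𝕜] X)
    (hB : 2 * (M * ‖B‖) ≤ β) :
    ∃ S, IsC0Semigroup S ∧ (∃ C, ∀ t, ‖S t‖ ≤ C) ∧ SolvesDuhamel T B S := by
  have hM : 0 ≤ M := nonneg_of_norm_le_mul_exp hb
  have hc : ∀ v : BoundedContinuousFunction ℝ≥0 X, Continuous fun p : ℝ≥0 × ℝ =>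
      T (p.1 - p.2.toNNReal) (B (v p.2.toNNReal)) := fun v =>
    hT.continuous_apply hb (by fun_prop) (B.continuous.comp (v.continuous.comp (by fun_prop)))
  have hint : ∀ (v : BoundedContinuousFunction ℝ≥0 X) (t : ℝ≥0) (a b : ℝ), IntervalIntegrable
      (fun s : ℝ => T (t - s.toNNReal) (B (v s.toNNReal))) volume a b := fun v t a b =>
    ((hc v).comp (by fun_prop : Continuous fun s : ℝ => (t, s))).intervalIntegrable _ _
  have hKb : ∀ (v : BoundedContinuousFunction ℝ≥0 X) (t : ℝ≥0),
      ‖∫ s in (0 : ℝ)..t, T (t - s.toNNReal) (B (v s.toNNReal))‖ ≤ 1 / 2 * ‖v‖ := fun v t => by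
    have h1 : ‖∫ s in (0 : ℝ)..t, T (t - s.toNNReal) (B (v s.toNNReal))‖ ≤
        ∫ s in (0 : ℝ)..t, M * ‖B‖ * ‖v‖ * Real.exp (-β * (t - s)) := by
      refine intervalIntegral.norm_integral_le_of_norm_le t.2 ?_
        (Continuous.intervalIntegrable (by fun_prop) _ _)
      filter_upwards with s hs
      refine ((T _).le_opNorm _).trans ?_
      have h2 := hb (t - s.toNNReal)
      rw [NNReal.coe_sub (Real.toNNReal_le_iff_le_coe.2 hs.2), Real.coe_toNNReal _ hs.1.le] at h2
      calc _ ≤ M * Real.exp (-β * (t - s)) * (‖B‖ * ‖v‖) := by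
            gcongr
            refine (B.le_opNorm _).trans ?_
            gcongr
            exact v.norm_coe_le_norm _
        _ = _ := by ring
    refine h1.trans ?_
    rw [intervalIntegral.integral_const_mul]
    have h3 := integral_exp_neg_mul_sub_le hβ t
    calc _ ≤ M * ‖B‖ * ‖v‖ * β⁻¹ := by gcongr
      _ = (2 * (M * ‖B‖)) * (β⁻¹ * ‖v‖ / 2) := by ring
      _ ≤ β * (β⁻¹ * ‖v‖ / 2) := by gcongr
      _ = 1 / 2 * ‖v‖ := by field_simp
  let K₀ : BoundedContinuousFunction ℝ≥0 X → BoundedContinuousFunction ℝ≥0 X := fun v =>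
    BoundedContinuousFunction.ofNormedAddCommGroup
      (fun t : ℝ≥0 => ∫ s in (0 : ℝ)..t, T (t - s.toNNReal) (B (v s.toNNReal)))
      (intervalIntegral.continuous_parametric_intervalIntegral_of_continuous (hc v)
        NNReal.continuous_coe) (1 / 2 * ‖v‖) (hKb v)
  have hK₀ : ∀ v t, K₀ v t = ∫ s in (0 : ℝ)..t, T (t - s.toNNReal) (B (v s.toNNReal)) :=
    fun v t => rfl
  let K₁ : BoundedContinuousFunction ℝ≥0 X →ₗ[𝕜] BoundedContinuousFunction ℝ≥0 X :=
    { toFun := K₀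
      map_add' := fun v w => by
        ext t
        rw [BoundedContinuousFunction.add_apply, hK₀, hK₀, hK₀,
          ← intervalIntegral.integral_add (hint v t _ _) (hint w t _ _)]
        simp
      map_smul' := fun c v => by
        ext t
        rw [RingHom.id_apply, BoundedContinuousFunction.smul_apply, hK₀, hK₀,
          ← intervalIntegral.integral_smul]
        simp }
  let K : BoundedContinuousFunction ℝ≥0 X →L[𝕜] BoundedContinuousFunction ℝ≥0 X :=
    K₁.mkContinuous (1 / 2) fun v =>
      (BoundedContinuousFunction.norm_le (by positivity)).2 (hKb v)
  have hK : ∀ v t, K v t = ∫ s in (0 : ℝ)..t, T (t - s.toNNReal) (B (v s.toNNReal)) :=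
    fun v t => rfl
  have hKn : ‖K‖ < 1 := (K₁.mkContinuous_norm_le (by norm_num) _).trans_lt (by norm_num)
  have hJb : ∀ (f : X) (t : ℝ≥0), ‖T t f‖ ≤ M * ‖f‖ := fun f t => by
    refine ((T t).le_opNorm f).trans (mul_le_mul_of_nonneg_right ((hb t).trans ?_) (norm_nonneg _))
    refine mul_le_of_le_one_right hM (Real.exp_le_one_iff.2 ?_)
    have := t.2
    have : 0 ≤ β * (t : ℝ) := by positivity
    linarith
  let J₁ : X →ₗ[𝕜] BoundedContinuousFunction ℝ≥0 X :=
    { toFun := fun f => BoundedContinuousFunction.ofNormedAddCommGroup (fun t : ℝ≥0 => T t f)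
        (hT.continuous f) (M * ‖f‖) (hJb f)
      map_add' := fun f g => by
        ext t
        simp
      map_smul' := fun c f => by
        ext t
        simp }
  let J : X →L[𝕜] BoundedContinuousFunction ℝ≥0 X :=
    J₁.mkContinuous M fun f =>
      (BoundedContinuousFunction.norm_le (by positivity)).2 (hJb f)
  have hJ : ∀ f t, J f t = T t f := fun f t => rfl
  obtain ⟨u, hu⟩ := isUnit_one_sub_of_norm_lt_one hKn
  let R : BoundedContinuousFunction ℝ≥0 X →L[𝕜] BoundedContinuousFunction ℝ≥0 X := ↑u⁻¹
  have hR1 : ∀ v, R v = v + K (R v) := fun v => by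
    have := congrArg (fun L => L v) u.mul_inv
    rw [hu] at this
    simp only [mul_apply_eq_comp, _root_.sub_apply,
      one_apply_eq_self] at this
    exact sub_eq_iff_eq_add.1 this
  have hR2 : ∀ v w, w = v + K w → w = R v := fun v w h => by
    have := congrArg (fun L => L w) u.inv_mul
    rw [hu] at this
    simp only [mul_apply_eq_comp, _root_.sub_apply,
      one_apply_eq_self] at this
    rw [← this]
    exact congrArg R (sub_eq_iff_eq_add.2 h)
  have hR3 : ∀ (f : X) (t : ℝ≥0), R (J f) t = T t f +
      ∫ s in (0 : ℝ)..t, T (t - s.toNNReal) (B (R (J f) s.toNNReal)) := fun f t => by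
    conv_lhs => rw [hR1 (J f)]
    rfl
  have hn : ∀ (f : X) (t : ℝ≥0), ‖R (J f) t‖ ≤ ‖R.comp J‖ * ‖f‖ := fun f t =>
    ((R (J f)).norm_coe_le_norm t).trans ((R.comp J).le_opNorm f)
  let S : ℝ≥0 → X →L[𝕜] X := fun t =>
    LinearMap.mkContinuous
      { toFun := fun f => R (J f) t
        map_add' := fun f g => by simp
        map_smul' := fun c f => by simp } ‖R.comp J‖ fun f => hn f t
  have hSd : ∀ f t, S t f = R (J f) t := fun f t => rfl
  refine ⟨S, ⟨?_, fun t s => ?_, fun f => (R (J f)).continuous⟩,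
    ⟨‖R.comp J‖, fun t => LinearMap.mkContinuous_norm_le _ (norm_nonneg _) _⟩, fun t f => hR3 f t⟩
  · ext f
    rw [hSd, hR3]
    simp [hT.zero_apply]
  · ext f
    rw [ContinuousLinearMap.comp_apply, hSd, hSd, hSd]
    set v := R (J f) with hv
    -- Semigroup law by uniqueness: the shifted orbit `w` solves the fixed-point equation with
    -- initial value `v s`.
    let w : BoundedContinuousFunction ℝ≥0 X := v.compContinuous ⟨fun t => t + s, by fun_prop⟩
    have hw : ∀ t, w t = v (t + s) := fun t => rfl
    rw [← hw]
    congr 1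
    refine hR2 _ _ ?_
    ext t
    rw [BoundedContinuousFunction.add_apply, hJ, hK, hw, hv, hR3, ← hv, hv, hR3, ← hv, map_add,
      ← hT.add_apply, add_assoc]
    congr 1
    rw [← intervalIntegral.integral_add_adjacent_intervals (hint v _ 0 s) (hint v _ s _)]
    congr 1
    · rw [← ContinuousLinearMap.intervalIntegral_comp_comm _ (hint v s _ _)]
      refine intervalIntegral.integral_congr fun r hr => ?_
      rw [Set.uIcc_of_le s.coe_nonneg] at hr
      rw [← hT.add_apply, add_tsub_assoc_of_le (Real.toNNReal_le_iff_le_coe.2 hr.2)]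
    · have h1 := intervalIntegral.integral_comp_add_right (a := 0) (b := t)
        (fun r : ℝ => T (t + s - r.toNNReal) (B (v r.toNNReal))) s
      rw [zero_add, ← NNReal.coe_add] at h1
      rw [← h1]
      refine intervalIntegral.integral_congr fun r hr => ?_
      rw [Set.uIcc_of_le t.coe_nonneg] at hr
      simp only [hw]
      rw [Real.toNNReal_add hr.1 s.coe_nonneg, Real.toNNReal_coe, add_tsub_add_eq_tsub_right]

/-- Bounded perturbation theorem. -/
theorem exists_solvesDuhamel {T : ℝ≥0 → X →L[𝕜] X} (hT : IsC0Semigroup T) {M ω : ℝ}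
    (hb : ∀ t : ℝ≥0, ‖T t‖ ≤ M * Real.exp (ω * t)) (B : X →L[𝕜] X) :
    ∃ S, IsC0Semigroup S ∧ (∃ C κ : ℝ, ∀ t : ℝ≥0, ‖S t‖ ≤ C * Real.exp (κ * t)) ∧
      SolvesDuhamel T B S := by
  have hM : 0 ≤ M := nonneg_of_norm_le_mul_exp hb
  -- Multiplying `T` by `e^{-κt}` with `κ = ω + β` gives decay rate exactly `β`, large enough for
  -- the preceding lemma; the factor is undone afterwards.
  set β : ℝ := 2 * (M * ‖B‖) + 1 with hβ
  have hβ0 : 0 < β := by positivity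
  set κ : ℝ := ω + β with hκ
  obtain ⟨S, hS, ⟨C, hC⟩, hSd⟩ := exists_solvesDuhamel_of_decay (hT.exp_smul (-κ)) hβ0 (M := M)
    (fun t => by
      rw [norm_exp_smul]
      calc _ ≤ Real.exp (-κ * t) * (M * Real.exp (ω * t)) := by gcongr; exact hb t
        _ = M * (Real.exp (-κ * t) * Real.exp (ω * t)) := by ring
        _ = _ := by
          rw [← Real.exp_add]
          congr 2
          rw [hκ]
          ring) B (by rw [hβ]; linarith)
  refine ⟨_, hS.exp_smul κ, ⟨C, κ, fun t => ?_⟩, fun t f => ?_⟩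
  · rw [norm_exp_smul, mul_comm]
    gcongr
    exact hC t
  · have hone : ∀ x : ℝ, ((Real.exp (κ * x) : ℝ) : 𝕜) * ((Real.exp (-κ * x) : ℝ) : 𝕜) = 1 :=
      fun x => by
        rw [← RCLike.ofReal_mul, ← Real.exp_add]
        simp
    rw [_root_.smul_apply, hSd t f, smul_add, _root_.smul_apply,
      smul_smul, hone, one_smul, ← intervalIntegral.integral_smul]
    congr 1
    refine intervalIntegral.integral_congr fun s hs => ?_
    rw [Set.uIcc_of_le t.coe_nonneg] at hs
    simp only [_root_.smul_apply, map_smul, smul_smul]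
    congr 1
    rw [← RCLike.ofReal_mul, ← Real.exp_add,
      NNReal.coe_sub (Real.toNNReal_le_iff_le_coe.2 hs.2), Real.coe_toNNReal _ hs.1]
    congr 2
    ring

end Perturbation

/-! ### Miyadera perturbations: uniform bounds and strong convergence. -/

section Miyadera

variable {𝕜 X : Type*} [RCLike 𝕜] [NormedAddCommGroup X] [NormedSpace 𝕜 X]

/-- The integral `∫₀ᵗ e^{-λs} ‖B T(s) f‖ ds` of Miyadera's perturbation condition. -/
noncomputable def miyaderaIntegral (T : ℝ≥0 → X →L[𝕜] X) (lam : ℝ) (B : X →L[𝕜] X) (t : ℝ)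
    (f : X) : ℝ :=
  ∫ s in (0 : ℝ)..t, Real.exp (-lam * s) * ‖B (T s.toNNReal f)‖

variable {T : ℝ≥0 → X →L[𝕜] X} {lam : ℝ}

theorem IsC0Semigroup.continuous_miyadera (hT : IsC0Semigroup T) (lam : ℝ) (B : X →L[𝕜] X) (f : X) :
    Continuous fun s : ℝ => Real.exp (-lam * s) * ‖B (T s.toNNReal f)‖ :=
  (by fun_prop : Continuous fun s : ℝ => Real.exp (-lam * s)).mul
    (B.continuous.comp ((hT.continuous f).comp continuous_real_toNNReal)).norm

theorem miyaderaIntegral_mono (hT : IsC0Semigroup T) (B : X →L[𝕜] X) (f : X) {s t : ℝ}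
    (hs : 0 ≤ s) (hst : s ≤ t) :
    miyaderaIntegral T lam B s f ≤ miyaderaIntegral T lam B t f :=
  intervalIntegral.integral_mono_interval le_rfl hs hst (ae_of_all _ fun s => by positivity)
    ((hT.continuous_miyadera lam B f).intervalIntegrable _ _)

/-- Splitting `e^{λ(t-s)} = e^{λt} e^{-λs}` turns a weighted bound for `P` into a Miyadera integral.
The additive term `b` absorbs errors uniform in `s`. -/
theorem norm_integral_duhamel_le [NormedSpace ℝ X] (hT : IsC0Semigroup T) (B : X →L[𝕜] X) (P : ℝ≥0 → X →L[𝕜] X)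
    (t : ℝ≥0) (f : X) {a b : ℝ}
    (h : ∀ s ≤ t, ‖P (t - s) (B (T s f))‖ ≤
      Real.exp (lam * (t - s : ℝ≥0)) * (a * ‖B (T s f)‖ + b)) :
    ‖∫ s in (0 : ℝ)..t, P (t - s.toNNReal) (B (T s.toNNReal f))‖ ≤
      Real.exp (lam * t) * (a * miyaderaIntegral T lam B t f +
        b * ∫ s in (0 : ℝ)..t, Real.exp (-lam * s)) := by
  have hc := hT.continuous_miyadera lam B f
  have hc' : Continuous fun s : ℝ => Real.exp (-lam * s) := by fun_prop
  have heq : Real.exp (lam * t) * (a * miyaderaIntegral T lam B t f +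
        b * ∫ s in (0 : ℝ)..t, Real.exp (-lam * s)) =
      ∫ s in (0 : ℝ)..t, Real.exp (lam * t) *
        (a * (Real.exp (-lam * s) * ‖B (T s.toNNReal f)‖) + b * Real.exp (-lam * s)) := by
    rw [intervalIntegral.integral_const_mul, intervalIntegral.integral_add
      ((hc.const_mul a).intervalIntegrable _ _) ((hc'.const_mul b).intervalIntegrable _ _),
      intervalIntegral.integral_const_mul, intervalIntegral.integral_const_mul, miyaderaIntegral]
  rw [heq]
  refine intervalIntegral.norm_integral_le_of_norm_le t.coe_nonneg ?_ ?_
  · filter_upwards with s hs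
    have hst : s.toNNReal ≤ t := Real.toNNReal_le_iff_le_coe.2 hs.2
    refine (h s.toNNReal hst).trans_eq ?_
    have : Real.exp (lam * (t - s.toNNReal : ℝ≥0)) = Real.exp (lam * t) * Real.exp (-lam * s) := by
      rw [← Real.exp_add, NNReal.coe_sub hst, Real.coe_toNNReal _ hs.1.le]
      congr 1
      ring
    rw [this]
    ring
  · exact (((hc.const_mul a).add (hc'.const_mul b)).const_mul _).intervalIntegrable _ _

/-- Each use of the Duhamel formula replaces a bound `c` by `M + α c`. Starting from any growth
bound of `S`, the excess over the fixed point `M/(1-α)` shrinks like `α ^ k`. -/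
theorem norm_le_of_miyaderaIntegral_le [NormedSpace ℝ X] (hT : IsC0Semigroup T) {M ω α : ℝ}
    (hb : ∀ t : ℝ≥0, ‖T t‖ ≤ M * Real.exp (ω * t)) (hlam : ω ≤ lam) (hα0 : 0 ≤ α) (hα1 : α < 1)
    {S : ℝ≥0 → X →L[𝕜] X} {C κ : ℝ} (hS : ∀ t : ℝ≥0, ‖S t‖ ≤ C * Real.exp (κ * t))
    {B : X →L[𝕜] X}
    (hd : ∀ (t : ℝ≥0) (f : X),
      S t f = T t f + ∫ s in (0 : ℝ)..t, S (t - s.toNNReal) (B (T s.toNNReal f)))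
    (hB : ∀ (t : ℝ≥0) (f : X), miyaderaIntegral T lam B t f ≤ α * ‖f‖) (τ : ℝ≥0) :
    ‖S τ‖ ≤ M / (1 - α) * Real.exp (lam * τ) := by
  have hM : 0 ≤ M := nonneg_of_norm_le_mul_exp hb
  have hC : 0 ≤ C := nonneg_of_norm_le_mul_exp hS
  have hα2 : 0 < 1 - α := sub_pos.2 hα1
  -- On `[0, τ]` this turns the a priori growth rate `κ` into the rate `lam`; the constant depends
  -- on `τ` but disappears as `k → ∞`.
  set C' : ℝ := C * Real.exp (|κ - lam| * τ)
  have key : ∀ (k : ℕ) (t : ℝ≥0), t ≤ τ → ∀ f : X,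
      ‖S t f‖ ≤ Real.exp (lam * t) * ((M / (1 - α) + α ^ k * C') * ‖f‖) := by
    intro k
    induction k with
    | zero =>
      intro t ht f
      refine ((S t).le_opNorm f).trans ?_
      have h1 : Real.exp (κ * t) ≤ Real.exp (lam * t) * Real.exp (|κ - lam| * τ) := by
        rw [← Real.exp_add]
        refine Real.exp_le_exp.2 ?_
        have h2 : (κ - lam) * t ≤ |κ - lam| * τ := by
          have : (t : ℝ) ≤ τ := ht
          exact mul_le_mul (le_abs_self _) this t.coe_nonneg (abs_nonneg _)
        linarith
      calc ‖S t‖ * ‖f‖ ≤ C * (Real.exp (lam * t) * Real.exp (|κ - lam| * τ)) * ‖f‖ := by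
            gcongr
            exact (hS t).trans (by gcongr)
        _ = Real.exp (lam * t) * ((0 + α ^ 0 * C') * ‖f‖) := by simp only [C']; ring
        _ ≤ _ := by gcongr; positivity
    | succ k ih =>
      intro t ht f
      rw [hd t f]
      have h1 : ‖T t f‖ ≤ Real.exp (lam * t) * (M * ‖f‖) := by
        have : Real.exp (ω * t) ≤ Real.exp (lam * t) := by gcongr
        calc ‖T t f‖ ≤ ‖T t‖ * ‖f‖ := (T t).le_opNorm f
          _ ≤ M * Real.exp (lam * t) * ‖f‖ := by
            gcongr
            exact (hb t).trans (by gcongr)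
          _ = _ := by ring
      have h2 := norm_integral_duhamel_le (lam := lam) (b := 0) hT B S t f fun s hs => by
        rw [add_zero]
        exact ih (t - s) (tsub_le_self.trans ht) _
      rw [zero_mul, add_zero] at h2
      refine (norm_add_le _ _).trans ((add_le_add h1 h2).trans ?_)
      have hC' : 0 ≤ C' := by positivity
      rw [← mul_add]
      refine mul_le_mul_of_nonneg_left ?_ (Real.exp_pos _).le
      calc M * ‖f‖ + (M / (1 - α) + α ^ k * C') * miyaderaIntegral T lam B t f
          ≤ M * ‖f‖ + (M / (1 - α) + α ^ k * C') * (α * ‖f‖) := by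
            gcongr
            exact hB t f
        _ = _ := by
            field_simp
            ring
  refine ContinuousLinearMap.opNorm_le_bound _ (by positivity) fun f => ?_
  have hlim : Tendsto (fun k : ℕ => Real.exp (lam * τ) * ((M / (1 - α) + α ^ k * C') * ‖f‖)) atTop
      (𝓝 (Real.exp (lam * τ) * ((M / (1 - α) + 0 * C') * ‖f‖))) :=
    ((((tendsto_pow_atTop_nhds_zero_of_lt_one hα0 hα1).mul_const _).const_add _).mul_const
      _).const_mul _
  refine (ge_of_tendsto' hlim fun k => key k τ le_rfl f).trans_eq ?_
  ring

/-- The uniform bound on `S n` makes the estimate stable under small changes of `f`, so finitely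
many indices suffice for a compact set. -/
theorem exists_forall_mem_norm_sub_le {S : ℕ → ℝ≥0 → X →L[𝕜] X} {C : ℝ}
    (hS : ∀ n (t : ℝ≥0), ‖S n t‖ ≤ C * Real.exp (lam * t)) {τ : ℝ≥0} {a : ℝ} (ha : 0 ≤ a)
    (h : ∀ (f : X) (ε : ℝ), 0 < ε → ∃ N : ℕ, ∀ n ≥ N, ∀ m ≥ N, ∀ t ≤ τ,
      ‖S n t f - S m t f‖ ≤ Real.exp (lam * t) * (a * ‖f‖ + ε))
    {K : Set X} (hK : IsCompact K) {ε : ℝ} (hε : 0 < ε) :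
    ∃ N : ℕ, ∀ n ≥ N, ∀ m ≥ N, ∀ t ≤ τ, ∀ f ∈ K,
      ‖S n t f - S m t f‖ ≤ Real.exp (lam * t) * (a * ‖f‖ + ε) := by
  have hC : 0 ≤ C := nonneg_of_norm_le_mul_exp (hS 0)
  refine hK.induction_on (p := fun K => ∃ N : ℕ, ∀ n ≥ N, ∀ m ≥ N, ∀ t ≤ τ, ∀ f ∈ K,
      ‖S n t f - S m t f‖ ≤ Real.exp (lam * t) * (a * ‖f‖ + ε)) ?_ ?_ ?_ ?_
  · exact ⟨0, fun _ _ _ _ _ _ f hf => absurd hf (Set.notMem_empty f)⟩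
  · rintro s t hst ⟨N, hN⟩
    exact ⟨N, fun n hn m hm r hr f hf => hN n hn m hm r hr f (hst hf)⟩
  · rintro s t ⟨N, hN⟩ ⟨N', hN'⟩
    refine ⟨max N N', fun n hn m hm r hr f hf => ?_⟩
    rcases hf with hf | hf
    · exact hN n (le_of_max_le_left hn) m (le_of_max_le_left hm) r hr f hf
    · exact hN' n (le_of_max_le_right hn) m (le_of_max_le_right hm) r hr f hf
  · intro g _
    obtain ⟨N, hN⟩ := h g (ε / 2) (half_pos hε)
    -- Moving from `g` to `f` costs `2 C ‖f - g‖` from the operators and `a ‖f - g‖` from the norm,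
    -- together at most `ε / 2`.
    have hδ : 0 < ε / 2 / (2 * C + a + 1) := by positivity
    refine ⟨_, mem_nhdsWithin_of_mem_nhds (Metric.ball_mem_nhds g hδ), N,
      fun n hn m hm t ht f hf => ?_⟩
    rw [Metric.mem_ball, dist_eq_norm, lt_div_iff₀ (by positivity)] at hf
    have h1 : ‖g‖ ≤ ‖f‖ + ‖f - g‖ := by
      have := norm_sub_le f (f - g)
      rwa [sub_sub_cancel] at this
    have h2 : ∀ n, ‖S n t (f - g)‖ ≤ C * Real.exp (lam * t) * ‖f - g‖ := fun n =>
      ((S n t).le_opNorm _).trans (by gcongr; exact hS n t)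
    have h3 : S n t f - S m t f = (S n t g - S m t g) + S n t (f - g) - S m t (f - g) := by
      rw [map_sub, map_sub]
      abel
    have h4 : ‖S n t f - S m t f‖ ≤ Real.exp (lam * t) * (a * ‖g‖ + ε / 2)
        + C * Real.exp (lam * t) * ‖f - g‖ + C * Real.exp (lam * t) * ‖f - g‖ := by
      rw [h3]
      exact (norm_sub_le _ _).trans (add_le_add ((norm_add_le _ _).trans
        (add_le_add (hN n hn m hm t ht) (h2 n))) (h2 m))
    calc _ ≤ _ := h4
      _ = Real.exp (lam * t) * (a * ‖g‖ + ε / 2 + 2 * C * ‖f - g‖) := by ring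
      _ ≤ Real.exp (lam * t) * (a * (‖f‖ + ‖f - g‖) + ε / 2 + 2 * C * ‖f - g‖) := by gcongr
      _ ≤ _ := by
        refine mul_le_mul_of_nonneg_left ?_ (Real.exp_pos _).le
        have := norm_nonneg (f - g)
        linarith

/-- In the Duhamel formulas for `S n` and `S m`, replace `B n` and `B m` by a fixed `B N₁`. The
replacement costs a small Miyadera integral; what remains is `S n - S m` applied to `B N₁ (T s f)`,
where the previous estimate gains a factor `α`. -/
theorem exists_norm_sub_le [NormedSpace ℝ X] (hT : IsC0Semigroup T) {α : ℝ} (hα0 : 0 ≤ α)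
    {S : ℕ → ℝ≥0 → X →L[𝕜] X} (hS0 : ∀ n, IsC0Semigroup (S n)) {C : ℝ}
    (hS : ∀ n (t : ℝ≥0), ‖S n t‖ ≤ C * Real.exp (lam * t)) {B : ℕ → X →L[𝕜] X}
    (hd : ∀ n (t : ℝ≥0) (f : X),
      S n t f = T t f + ∫ s in (0 : ℝ)..t, S n (t - s.toNNReal) (B n (T s.toNNReal f)))
    (hB : ∀ n (t : ℝ≥0) (f : X), miyaderaIntegral T lam (B n) t f ≤ α * ‖f‖)
    (hB' : ∀ (t : ℝ≥0) (f : X) (ε : ℝ), 0 < ε →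
      ∃ N, ∀ n ≥ N, miyaderaIntegral T lam (B n - B N) t f ≤ ε) (τ : ℝ≥0) (k : ℕ) :
    ∀ (f : X) (ε : ℝ), 0 < ε → ∃ N : ℕ, ∀ n ≥ N, ∀ m ≥ N, ∀ t ≤ τ,
      ‖S n t f - S m t f‖ ≤ Real.exp (lam * t) * (α ^ k * (2 * C) * ‖f‖ + ε) := by
  have hC : 0 ≤ C := nonneg_of_norm_le_mul_exp (hS 0)
  have hSn : ∀ n (t : ℝ≥0) f, ‖S n t f‖ ≤ Real.exp (lam * t) * (C * ‖f‖) := fun n t f =>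
    ((S n t).le_opNorm f).trans (by
      calc _ ≤ C * Real.exp (lam * t) * ‖f‖ := by gcongr; exact hS n t
        _ = _ := by ring)
  induction k with
  | zero =>
    intro f ε hε
    refine ⟨0, fun n _ m _ t _ => ?_⟩
    refine (norm_sub_le _ _).trans ((add_le_add (hSn n t f) (hSn m t f)).trans ?_)
    rw [← mul_add, pow_zero]
    refine mul_le_mul_of_nonneg_left ?_ (Real.exp_pos _).le
    linarith
  | succ k ih =>
    intro f ε hε
    set E : ℝ := ∫ s in (0 : ℝ)..τ, Real.exp (-lam * s) with hE
    have hexp : Continuous fun s : ℝ => Real.exp (-lam * s) := by fun_prop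
    have hE0 : 0 ≤ E := intervalIntegral.integral_nonneg τ.coe_nonneg fun s _ => by positivity
    set ε₁ : ℝ := ε / 2 / (2 * C + 1) with hε₁
    set ε₂ : ℝ := ε / 2 / (E + 1) with hε₂
    have hε₁0 : 0 < ε₁ := by positivity
    have hε₂0 : 0 < ε₂ := by positivity
    obtain ⟨N₁, hN₁⟩ := hB' τ f ε₁ hε₁0
    -- Fixing `N₁` first makes the vectors `B N₁ (T s f)`, `s ∈ [0, τ]`, a compact set independent
    -- of `n` and `m`, so the induction hypothesis holds uniformly on it.
    have hcT : Continuous fun s : ℝ≥0 => B N₁ (T s f) := (B N₁).continuous.comp (hT.continuous f)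
    obtain ⟨N₂, hN₂⟩ := exists_forall_mem_norm_sub_le hS (by positivity) ih
      ((isCompact_Icc (a := (0 : ℝ≥0)) (b := τ)).image hcT) hε₂0
    refine ⟨max N₁ N₂, fun n hn m hm t ht => ?_⟩
    have htτ : (t : ℝ) ≤ τ := ht
    have hint : ∀ (j : ℕ) (D : X →L[𝕜] X), IntervalIntegrable
        (fun s : ℝ => S j (t - s.toNNReal) (D (T s.toNNReal f))) volume 0 t := fun j D =>
      ((hS0 j).continuous_apply (hS j) (by fun_prop) (D.continuous.comp ((hT.continuous f).comp
        continuous_real_toNNReal))).intervalIntegrable _ _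
    have h0 : ∀ j, S j t f - T t f =
        (∫ s in (0 : ℝ)..t, S j (t - s.toNNReal) ((B j - B N₁) (T s.toNNReal f))) +
        ∫ s in (0 : ℝ)..t, S j (t - s.toNNReal) (B N₁ (T s.toNNReal f)) := fun j => by
      rw [← intervalIntegral.integral_add (hint j _) (hint j _), hd j t f, add_sub_cancel_left]
      simp
    have h1 : S n t f - S m t f =
        (∫ s in (0 : ℝ)..t, S n (t - s.toNNReal) ((B n - B N₁) (T s.toNNReal f))) -
        (∫ s in (0 : ℝ)..t, S m (t - s.toNNReal) ((B m - B N₁) (T s.toNNReal f))) +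
        ∫ s in (0 : ℝ)..t, (fun r => S n r - S m r) (t - s.toNNReal) (B N₁ (T s.toNNReal f)) := by
      have e : (∫ s in (0 : ℝ)..t, (fun r => S n r - S m r) (t - s.toNNReal)
          (B N₁ (T s.toNNReal f))) =
          (∫ s in (0 : ℝ)..t, S n (t - s.toNNReal) (B N₁ (T s.toNNReal f))) -
          ∫ s in (0 : ℝ)..t, S m (t - s.toNNReal) (B N₁ (T s.toNNReal f)) := by
        rw [← intervalIntegral.integral_sub (hint n _) (hint m _)]
        simp
      rw [e, ← sub_sub_sub_cancel_right _ _ (T t f), h0 n, h0 m]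
      abel
    have h2 : ∀ j ≥ N₁, ‖∫ s in (0 : ℝ)..t,
        S j (t - s.toNNReal) ((B j - B N₁) (T s.toNNReal f))‖ ≤ Real.exp (lam * t) * (C * ε₁) :=
      fun j hj => by
        have := norm_integral_duhamel_le (lam := lam) (a := C) (b := 0) hT (B j - B N₁) (S j) t f
          fun s hs => by
            rw [add_zero]
            exact hSn _ _ _
        refine this.trans ?_
        rw [zero_mul, add_zero]
        gcongr
        exact (miyaderaIntegral_mono hT _ f t.coe_nonneg htτ).trans (hN₁ j hj)
    have h3 := norm_integral_duhamel_le (lam := lam) hT (B N₁) (fun r => S n r - S m r) t f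
      fun s hs => hN₂ n (le_of_max_le_right hn) m (le_of_max_le_right hm) (t - s)
        (tsub_le_self.trans ht) (B N₁ (T s f)) ⟨s, ⟨zero_le, hs.trans ht⟩, rfl⟩
    have hEt : ∫ s in (0 : ℝ)..t, Real.exp (-lam * s) ≤ E :=
      intervalIntegral.integral_mono_interval le_rfl t.coe_nonneg htτ
        (ae_of_all _ fun s => (Real.exp_pos _).le) (hexp.intervalIntegrable _ _)
    rw [h1]
    refine (norm_add_le _ _).trans ((add_le_add ((norm_sub_le _ _).trans
      (add_le_add (h2 n (le_of_max_le_left hn)) (h2 m (le_of_max_le_left hm)))) h3).trans ?_)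
    rw [← mul_add, ← mul_add]
    refine mul_le_mul_of_nonneg_left ?_ (Real.exp_pos _).le
    have e1 : (2 * C + 1) * ε₁ = ε / 2 := by rw [hε₁]; field_simp
    have e2 : (E + 1) * ε₂ = ε / 2 := by rw [hε₂]; field_simp
    calc _ ≤ C * ε₁ + C * ε₁ + (α ^ k * (2 * C) * (α * ‖f‖) + ε₂ * E) := by
          gcongr
          exact hB N₁ t f
      _ ≤ _ := by
          rw [pow_succ]
          linarith

/-- Miyadera perturbations: strong convergence of the perturbed semigroups. -/
theorem exists_tendsto_isC0Semigroup [NormedSpace ℝ X] [CompleteSpace X] (hT : IsC0Semigroup T)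
    {α : ℝ} (hα0 : 0 ≤ α) (hα1 : α < 1)
    {S : ℕ → ℝ≥0 → X →L[𝕜] X} (hS0 : ∀ n, IsC0Semigroup (S n)) {C : ℝ}
    (hS : ∀ n (t : ℝ≥0), ‖S n t‖ ≤ C * Real.exp (lam * t)) {B : ℕ → X →L[𝕜] X}
    (hd : ∀ n (t : ℝ≥0) (f : X),
      S n t f = T t f + ∫ s in (0 : ℝ)..t, S n (t - s.toNNReal) (B n (T s.toNNReal f)))
    (hB : ∀ n (t : ℝ≥0) (f : X), miyaderaIntegral T lam (B n) t f ≤ α * ‖f‖)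
    (hB' : ∀ (t : ℝ≥0) (f : X) (ε : ℝ), 0 < ε →
      ∃ N, ∀ n ≥ N, miyaderaIntegral T lam (B n - B N) t f ≤ ε) :
    ∃ U : ℝ≥0 → X →L[𝕜] X, IsC0Semigroup U ∧
      (∀ t f, Tendsto (fun n => S n t f) atTop (𝓝 (U t f))) ∧
      ∀ t : ℝ≥0, ‖U t‖ ≤ C * Real.exp (lam * t) := by
  have hC : 0 ≤ C := nonneg_of_norm_le_mul_exp (hS 0)
  have hcau : ∀ (f : X) (τ : ℝ≥0), UniformCauchySeqOn (fun n t => S n t f) atTop (Set.Iic τ) := by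
    intro f τ
    rw [Metric.uniformCauchySeqOn_iff]
    intro ε hε
    -- `G` bounds `e^{λt}` on `[0, τ]` for either sign of `lam`; the 3 in `η` makes `2 G η < ε`
    -- strict.
    set G : ℝ := Real.exp (|lam| * τ) with hG
    have hG0 : 0 < G := Real.exp_pos _
    set η : ℝ := ε / (3 * G) with hη
    have hη0 : 0 < η := by positivity
    have hlim : Tendsto (fun k : ℕ => α ^ k * (2 * C) * ‖f‖) atTop (𝓝 (0 * (2 * C) * ‖f‖)) :=
      ((tendsto_pow_atTop_nhds_zero_of_lt_one hα0 hα1).mul_const _).mul_const _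
    rw [zero_mul, zero_mul] at hlim
    obtain ⟨k, hk⟩ := (hlim.eventually_lt_const hη0).exists
    obtain ⟨N, hN⟩ := exists_norm_sub_le hT hα0 hS0 hS hd hB hB' τ k f η hη0
    refine ⟨N, fun m hm n hn t ht => ?_⟩
    rw [dist_eq_norm]
    have hle : Real.exp (lam * t) ≤ G := by
      refine Real.exp_le_exp.2 (mul_le_mul (le_abs_self _) ?_ t.coe_nonneg (abs_nonneg _))
      exact_mod_cast ht
    calc _ ≤ Real.exp (lam * t) * (α ^ k * (2 * C) * ‖f‖ + η) := hN m hm n hn t ht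
      _ ≤ G * (η + η) := by gcongr
      _ < ε := by
        rw [hη]
        field_simp
        norm_num
  have hlim : ∀ (t : ℝ≥0) (f : X), ∃ y, Tendsto (fun n => S n t f) atTop (𝓝 y) := fun t f =>
    cauchySeq_tendsto_of_complete ((hcau f t).cauchySeq (Set.mem_Iic.2 le_rfl))
  choose u hu using hlim
  let U : ℝ≥0 → X →L[𝕜] X := fun t =>
    continuousLinearMapOfTendsto (fun n => S n t) (tendsto_pi_nhds.2 (hu t))
  have hU : ∀ t f, Tendsto (fun n => S n t f) atTop (𝓝 (U t f)) := hu
  refine ⟨U, ⟨?_, fun s t => ?_, fun f => ?_⟩, hU, fun t => ?_⟩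
  · ext f
    refine tendsto_nhds_unique (hU 0 f) ?_
    simp [(hS0 _).zero_apply]
  · ext f
    refine tendsto_nhds_unique (hU (s + t) f) ?_
    simp only [(hS0 _).add_apply, ContinuousLinearMap.comp_apply]
    have h1 : Tendsto (fun n => S n s (S n t f - U t f)) atTop (𝓝 0) := by
      have h2 : Tendsto (fun n => C * Real.exp (lam * s) * ‖S n t f - U t f‖) atTop
          (𝓝 (C * Real.exp (lam * s) * ‖U t f - U t f‖)) :=
        ((hU t f).sub_const _).norm.const_mul _
      rw [sub_self, norm_zero, mul_zero] at h2
      exact squeeze_zero_norm (fun n => ((S n s).le_opNorm _).trans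
        (mul_le_mul_of_nonneg_right (hS n s) (norm_nonneg _))) h2
    simpa using h1.add (hU s (U t f))
  · refine continuous_iff_continuousAt.2 fun t => ?_
    have := ((hcau f (t + 1)).tendstoUniformlyOn_of_tendsto fun s _ => hU s f).continuousOn
      (Frequently.of_forall fun n => ((hS0 n).continuous f).continuousOn)
    exact this.continuousAt (Iic_mem_nhds (lt_add_of_pos_right t one_pos))
  · refine ContinuousLinearMap.opNorm_le_bound _ (by positivity) fun f => ?_
    refine le_of_tendsto' (hU t f).norm fun n => ((S n t).le_opNorm f).trans ?_
    gcongr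
    exact hS n t

end Miyadera

/-! ### Generator and resolvent. -/

section Generator

variable {𝕜 X : Type*} [RCLike 𝕜] [NormedAddCommGroup X] [NormedSpace 𝕜 X] {T : ℝ≥0 → X →L[𝕜] X}

theorem norm_exp_neg_smul_le {B : X →L[𝕜] X} {M ω : ℝ} (lam : ℝ) {t : ℝ≥0}
    (hB : ‖B‖ ≤ M * Real.exp (ω * t)) :
    ‖((Real.exp (-lam * t) : ℝ) : 𝕜) • B‖ ≤ M * Real.exp ((ω - lam) * t) := by
  rw [norm_exp_smul]
  calc _ ≤ Real.exp (-lam * t) * (M * Real.exp (ω * t)) := by gcongr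
    _ = M * (Real.exp (-lam * t) * Real.exp (ω * t)) := by ring
    _ = _ := by
      rw [← Real.exp_add]
      congr 2
      ring

theorem mem_semigroupGenerator_domain {f : X} :
    f ∈ (semigroupGenerator T).domain ↔ ∃ g, HasOrbitDeriv T f g :=
  Iff.rfl

theorem hasOrbitDeriv_semigroupGenerator (f : (semigroupGenerator T).domain) :
    HasOrbitDeriv T f (semigroupGenerator T f) :=
  f.2.choose_spec

theorem HasOrbitDeriv.semigroupGenerator_eq {f g : X} (h : HasOrbitDeriv T f g)
    (hf : f ∈ (semigroupGenerator T).domain) : semigroupGenerator T ⟨f, hf⟩ = g :=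
  (hasOrbitDeriv_semigroupGenerator ⟨f, hf⟩).unique h

theorem HasOrbitDeriv.exp_smul {f g : X} (h : HasOrbitDeriv T f g) (κ : ℝ) :
    HasOrbitDeriv (fun t : ℝ≥0 => ((Real.exp (κ * t) : ℝ) : 𝕜) • T t) f ((κ : 𝕜) • f + g) := by
  have h1 : HasDerivAt (fun t : ℝ => Real.exp (κ * t)) κ 0 := by
    have := ((hasDerivAt_id (0 : ℝ)).const_mul κ).exp
    simpa using this
  have h3 := (RCLike.continuous_ofReal (K := 𝕜)).continuousAt.tendsto.comp
    (h1.tendsto_slope_zero_right.comp tendsto_coe_nhdsGT_zero)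
  have h4 : Tendsto (fun t : ℝ≥0 => ((Real.exp (κ * t) : ℝ) : 𝕜)) (𝓝[>] 0) (𝓝 1) := by
    have : Continuous fun t : ℝ≥0 => ((Real.exp (κ * t) : ℝ) : 𝕜) :=
      RCLike.continuous_ofReal.comp (by fun_prop)
    simpa using (this.tendsto 0).mono_left nhdsWithin_le_nhds
  have h5 := (h3.smul_const f).add (h4.smul h)
  rw [one_smul] at h5
  refine h5.congr fun t => ?_
  simp only [Function.comp_apply, zero_add, mul_zero, Real.exp_zero, smul_eq_mul, RCLike.ofReal_mul,
    RCLike.ofReal_inv, RCLike.ofReal_sub, RCLike.ofReal_one, _root_.smul_apply]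
  module

variable [NormedSpace ℝ X] [IsScalarTower ℝ 𝕜 X]

theorem IsC0Semigroup.apply_eq_of_hasOrbitDeriv_zero (hT : IsC0Semigroup T) {f : X}
    (h : HasOrbitDeriv T f 0) (t : ℝ≥0) : T t f = f := by
  have hc : Continuous fun s : ℝ => T s.toNNReal f :=
    (hT.continuous f).comp continuous_real_toNNReal
  have := constant_of_has_deriv_right_zero (a := 0) (b := t) hc.continuousOn ?_ t
    ⟨t.coe_nonneg, le_rfl⟩
  · simpa [hT.zero_apply] using this
  · intro s hs
    rw [← hasDerivWithinAt_Ioi_iff_Ici]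
    have hd := (_root_.hasOrbitDeriv_iff hT).1 h
    rw [hasDerivWithinAt_iff_tendsto_slope' (by simp)] at hd ⊢
    have := ((T s.toNNReal).continuous.tendsto _).comp (hd.comp (tendsto_sub_const_nhdsGT s))
    rw [_root_.map_zero] at this
    refine this.congr' ?_
    filter_upwards [self_mem_nhdsWithin] with x hx
    have hxs : 0 ≤ x - s := (sub_pos.2 hx).le
    have e1 : x.toNNReal = s.toNNReal + (x - s).toNNReal := by
      rw [← Real.toNNReal_add hs.1 hxs, add_sub_cancel]
    simp only [Function.comp_apply, slope_def_module, sub_zero, Real.toNNReal_zero,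
      hT.zero_apply]
    rw [RCLike.real_smul_eq_coe_smul (K := 𝕜), RCLike.real_smul_eq_coe_smul (K := 𝕜), map_smul,
      map_sub, e1, hT.add_apply]

/-- The rescaled orbit `e^{-λt} T(t) f` has zero derivative, hence is constant, yet it decays
because `ω < λ`. -/
theorem IsC0Semigroup.eq_zero_of_hasOrbitDeriv_smul (hT : IsC0Semigroup T) {M ω lam : ℝ}
    (hb : ∀ t : ℝ≥0, ‖T t‖ ≤ M * Real.exp (ω * t)) (hlam : ω < lam) {f : X}
    (h : HasOrbitDeriv T f ((lam : 𝕜) • f)) : f = 0 := by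
  have h0 := h.exp_smul (-lam)
  rw [RCLike.ofReal_neg, neg_smul, neg_add_cancel] at h0
  have h1 := (hT.exp_smul (-lam)).apply_eq_of_hasOrbitDeriv_zero h0
  have h2 : ∀ t : ℝ≥0, ‖f‖ ≤ M * Real.exp ((ω - lam) * t) * ‖f‖ := fun t => by
    conv_lhs => rw [← h1 t]
    refine (ContinuousLinearMap.le_opNorm _ f).trans ?_
    exact mul_le_mul_of_nonneg_right (norm_exp_neg_smul_le lam (hb t)) (norm_nonneg _)
  have h3 : Tendsto (fun t : ℝ≥0 => M * Real.exp ((ω - lam) * t) * ‖f‖) atTop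
      (𝓝 (M * 0 * ‖f‖)) := by
    refine ((Real.tendsto_exp_atBot.comp ?_).const_mul M).mul_const _
    exact (NNReal.tendsto_coe_atTop.2 tendsto_id).const_mul_atTop_of_neg (sub_neg.2 hlam)
  rw [mul_zero, zero_mul] at h3
  exact norm_le_zero_iff.1 (ge_of_tendsto' h3 h2)

/-- `LinearPMap.inverse` is meaningful only for a trivial kernel, which the preceding lemma
supplies. Surjectivity of `λ - A` is not needed, as the preimage is given explicitly. -/
theorem resolventOperator_apply (hT : IsC0Semigroup T) {M ω lam : ℝ}
    (hb : ∀ t : ℝ≥0, ‖T t‖ ≤ M * Real.exp (ω * t)) (hlam : ω < lam) {f g : X}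
    (h : HasOrbitDeriv T f g) :
    ∃ y : (resolventOperator (semigroupGenerator T) (lam : 𝕜)).domain,
      (y : X) = (lam : 𝕜) • f - g ∧ resolventOperator (semigroupGenerator T) (lam : 𝕜) y = f := by
  set L : X →ₗ.[𝕜] X :=
    (((lam : 𝕜) • (LinearMap.id : X →ₗ[𝕜] X)).toPMap ⊤ - semigroupGenerator T) with hL
  have hLapp : ∀ x : L.domain, L x = (lam : 𝕜) • (x : X) - semigroupGenerator T ⟨x, x.2.2⟩ :=
    fun x => rfl
  have hker : L.toFun.ker = ⊥ := by
    rw [LinearMap.ker_eq_bot']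
    intro x hx
    have h1 : (lam : 𝕜) • (x : X) - semigroupGenerator T ⟨x, x.2.2⟩ = 0 := hx
    have h2 := hasOrbitDeriv_semigroupGenerator (T := T) ⟨x, x.2.2⟩
    rw [← sub_eq_zero.1 h1] at h2
    exact Subtype.ext (hT.eq_zero_of_hasOrbitDeriv_smul hb hlam h2)
  let x : L.domain := ⟨f, trivial, ⟨g, h⟩⟩
  have hx : L x = (lam : 𝕜) • f - g := by
    rw [hLapp, h.semigroupGenerator_eq]
  have hdom : (lam : 𝕜) • f - g ∈ L.inverse.domain := by
    rw [LinearPMap.inverse_domain]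
    exact ⟨x, hx⟩
  exact ⟨⟨_, hdom⟩, rfl, LinearPMap.inverse_apply_eq hker (y := ⟨_, hdom⟩) (x := x) hx⟩

/-- `T(x)` shifts the interval of integration to `[x, x + τ]`, and the fundamental theorem of
calculus differentiates both endpoints. -/
theorem IsC0Semigroup.hasOrbitDeriv_integral [CompleteSpace X] (hT : IsC0Semigroup T) (τ : ℝ≥0)
    (f : X) :
    HasOrbitDeriv T (∫ s in (0 : ℝ)..τ, T s.toNNReal f) (T τ f - f) := by
  have hc : Continuous fun s : ℝ => T s.toNNReal f :=
    (hT.continuous f).comp continuous_real_toNNReal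
  rw [hasOrbitDeriv_iff hT]
  have hP : ∀ x : ℝ, HasDerivAt (fun x : ℝ => ∫ s in (0 : ℝ)..x, T s.toNNReal f)
      (T x.toNNReal f) x := fun x => (hc.integral_hasStrictDerivAt 0 x).hasDerivAt
  have h1 : HasDerivAt (fun x : ℝ => (∫ s in (0 : ℝ)..(x + τ), T s.toNNReal f) -
      ∫ s in (0 : ℝ)..x, T s.toNNReal f) (T τ f - f) 0 := by
    have h2 := (hP (0 + τ)).comp_add_const 0 (τ : ℝ)
    have h3 := h2.sub (hP 0)
    simpa [hT.zero_apply, Pi.sub_def] using h3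
  refine h1.hasDerivWithinAt.congr_of_eventuallyEq ?_ ?_
  · filter_upwards [self_mem_nhdsWithin] with x hx
    have hx0 : 0 ≤ x := le_of_lt hx
    rw [← ContinuousLinearMap.intervalIntegral_comp_comm _ (hc.intervalIntegrable _ _),
      intervalIntegral.integral_interval_sub_left (hc.intervalIntegrable _ _)
        (hc.intervalIntegrable _ _)]
    have := intervalIntegral.integral_comp_add_right (a := 0) (b := τ)
        (fun r : ℝ => T r.toNNReal f) x
    rw [zero_add, add_comm (τ : ℝ)] at this
    rw [← this]
    refine intervalIntegral.integral_congr fun r hr => ?_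
    rw [Set.uIcc_of_le τ.coe_nonneg] at hr
    rw [← hT.add_apply, Real.toNNReal_add hr.1 hx0, add_comm]
  · simp [hT.zero_apply]

/-- `∫₀^τ e^{-λs} T(s) f ds = (λ - A)⁻¹ (f - e^{-λτ} T(τ) f)`. -/
theorem exists_resolventOperator_eq_integral [CompleteSpace X] (hT : IsC0Semigroup T) {M ω lam : ℝ}
    (hb : ∀ t : ℝ≥0, ‖T t‖ ≤ M * Real.exp (ω * t)) (hlam : ω < lam) (τ : ℝ≥0) (f : X) :
    ∃ y : (resolventOperator (semigroupGenerator T) (lam : 𝕜)).domain,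
      ‖(y : X)‖ ≤ (1 + M * Real.exp ((ω - lam) * τ)) * ‖f‖ ∧
      resolventOperator (semigroupGenerator T) (lam : 𝕜) y =
        ∫ s in (0 : ℝ)..τ, ((Real.exp (-lam * s.toNNReal) : ℝ) : 𝕜) • T s.toNNReal f := by
  -- The derivative is computed for `e^{-λt} T(t)`; scaling back by `e^{λt}` adds `λ` times the
  -- integral.
  have h := ((hT.exp_smul (-lam)).hasOrbitDeriv_integral τ f).exp_smul lam
  have hTT : (fun t : ℝ≥0 => ((Real.exp (lam * t) : ℝ) : 𝕜) •
      (fun t : ℝ≥0 => ((Real.exp (-lam * t) : ℝ) : 𝕜) • T t) t) = T := by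
    funext t
    rw [smul_smul, ← RCLike.ofReal_mul, ← Real.exp_add]
    simp
  rw [hTT] at h
  obtain ⟨y, hy, hy'⟩ := resolventOperator_apply hT hb hlam h
  refine ⟨y, ?_, hy'⟩
  rw [hy, sub_add_cancel_left, neg_sub, add_mul, one_mul]
  refine (norm_sub_le _ _).trans (add_le_add_right ?_ _)
  refine (ContinuousLinearMap.le_opNorm _ f).trans ?_
  exact mul_le_mul_of_nonneg_right (norm_exp_neg_smul_le lam (hb τ)) (norm_nonneg _)

end Generator

/-! ### Positive operators and the modulus. -/

section Positive

variable {Ω 𝕜 : Type*} [MeasurableSpace Ω] [RCLike 𝕜] {μ : Measure Ω}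

theorem memLp_ofReal_norm (f : Lp 𝕜 1 μ) : MemLp (fun x => ((‖f x‖ : ℝ) : 𝕜)) 1 μ :=
  (Lp.memLp f).norm.ofReal

/-- The modulus `|f|` as an element of the same `L₁`-space. -/
noncomputable def absLp (f : Lp 𝕜 1 μ) : Lp 𝕜 1 μ :=
  (memLp_ofReal_norm f).toLp

theorem coeFn_absLp (f : Lp 𝕜 1 μ) : absLp f =ᵐ[μ] fun x => ((‖f x‖ : ℝ) : 𝕜) :=
  (memLp_ofReal_norm f).coeFn_toLp

theorem norm_absLp (f : Lp 𝕜 1 μ) : ‖absLp f‖ = ‖f‖ := by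
  rw [L1.norm_eq_integral_norm, L1.norm_eq_integral_norm]
  refine integral_congr_ae ?_
  filter_upwards [coeFn_absLp f] with x hx
  rw [hx, RCLike.norm_ofReal, abs_norm]

variable {S : Lp 𝕜 1 μ →L[𝕜] Lp 𝕜 1 μ}

theorem IsPositiveOperator.apply_absLp_nonneg (hS : IsPositiveOperator S) (f : Lp 𝕜 1 μ) :
    ∀ᵐ x ∂μ, 0 ≤ RCLike.re (S (absLp f) x) ∧ RCLike.im (S (absLp f) x) = 0 := by
  refine hS _ ?_
  filter_upwards [coeFn_absLp f] with x hx
  rw [hx, RCLike.ofReal_re, RCLike.ofReal_im]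
  exact ⟨norm_nonneg _, rfl⟩

theorem IsPositiveOperator.apply_absLp_sub_nonneg (hS : IsPositiveOperator S) {f g : Lp 𝕜 1 μ}
    (hg : ∀ᵐ x ∂μ, RCLike.re (g x) ≤ ‖f x‖ ∧ RCLike.im (g x) = 0) :
    ∀ᵐ x ∂μ, RCLike.re (S g x) ≤ RCLike.re (S (absLp f) x) ∧ RCLike.im (S g x) = 0 := by
  have h1 := hS (absLp f - g) (by
    filter_upwards [hg, coeFn_absLp f, Lp.coeFn_sub (absLp f) g] with x hx h1 h2
    rw [h2, Pi.sub_apply, h1, map_sub, map_sub, RCLike.ofReal_re, RCLike.ofReal_im, hx.2, sub_zero]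
    exact ⟨sub_nonneg.2 hx.1, rfl⟩)
  rw [map_sub] at h1
  filter_upwards [h1, Lp.coeFn_sub (S (absLp f)) (S g), hS.apply_absLp_nonneg f] with x h2 h3 h4
  rw [h3, Pi.sub_apply, map_sub, map_sub, h4.2] at h2
  exact ⟨sub_nonneg.1 h2.1, by simpa using h2.2⟩

/-- A positive operator maps real functions to real ones, so `Re (S f) = S (Re f)`, and `Re f ≤
|f|`. -/
theorem IsPositiveOperator.re_apply_le (hS : IsPositiveOperator S) (f : Lp 𝕜 1 μ) :
    ∀ᵐ x ∂μ, RCLike.re (S f x) ≤ RCLike.re (S (absLp f) x) := by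
  have hu : MemLp (fun x => ((RCLike.re (f x) : ℝ) : 𝕜)) 1 μ := (Lp.memLp f).re.ofReal
  have hv : MemLp (fun x => ((RCLike.im (f x) : ℝ) : 𝕜)) 1 μ := (Lp.memLp f).im.ofReal
  have hf : f = hu.toLp + (RCLike.I : 𝕜) • hv.toLp := by
    refine Lp.ext ?_
    filter_upwards [Lp.coeFn_add hu.toLp ((RCLike.I : 𝕜) • hv.toLp),
      Lp.coeFn_smul (RCLike.I : 𝕜) hv.toLp, hu.coeFn_toLp, hv.coeFn_toLp] with x h1 h2 h3 h4
    rw [h1, Pi.add_apply, h2, Pi.smul_apply, h3, h4, smul_eq_mul, mul_comm, RCLike.re_add_im]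
  have h1 := hS.apply_absLp_sub_nonneg (f := f) (g := hu.toLp) (by
    filter_upwards [hu.coeFn_toLp] with x hx
    rw [hx, RCLike.ofReal_re, RCLike.ofReal_im]
    exact ⟨RCLike.re_le_norm _, rfl⟩)
  have h2 := hS.apply_absLp_sub_nonneg (f := f) (g := hv.toLp) (by
    filter_upwards [hv.coeFn_toLp] with x hx
    rw [hx, RCLike.ofReal_re, RCLike.ofReal_im]
    exact ⟨RCLike.im_le_norm _, rfl⟩)
  have h3 : S f = S hu.toLp + (RCLike.I : 𝕜) • S hv.toLp := by
    conv_lhs => rw [hf]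
    rw [map_add, map_smul]
  rw [h3]
  filter_upwards [h1, h2, Lp.coeFn_add (S hu.toLp) ((RCLike.I : 𝕜) • S hv.toLp),
    Lp.coeFn_smul (RCLike.I : 𝕜) (S hv.toLp)] with x h4 h5 h6 h7
  rw [h6, Pi.add_apply, h7, Pi.smul_apply, smul_eq_mul, map_add, RCLike.I_mul_re, h5.2, neg_zero,
    add_zero]
  exact h4.1

/-- A positive operator satisfies `|S f| ≤ S |f|`. -/
theorem IsPositiveOperator.norm_apply_le (hS : IsPositiveOperator S) (f : Lp 𝕜 1 μ) :
    ∀ᵐ x ∂μ, ‖S f x‖ ≤ RCLike.re (S (absLp f) x) := by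
  -- Rotate `f` by `c`. The null set depends on `c`, so a countable dense set of `c` is used first;
  -- continuity then allows `c` to be the conjugate of `S f x`.
  have h1 : ∀ c : 𝕜, ∀ᵐ x ∂μ, RCLike.re (c * S f x) ≤ ‖c‖ * RCLike.re (S (absLp f) x) := by
    intro c
    have habs : absLp (c • f) = ((‖c‖ : ℝ) : 𝕜) • absLp f := by
      refine Lp.ext ?_
      filter_upwards [coeFn_absLp (c • f), coeFn_absLp f, Lp.coeFn_smul c f,
        Lp.coeFn_smul ((‖c‖ : ℝ) : 𝕜) (absLp f)] with x h1 h2 h3 h4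
      rw [h1, h3, h4, Pi.smul_apply, Pi.smul_apply, h2, norm_smul, smul_eq_mul, RCLike.ofReal_mul]
    have h2 := hS.re_apply_le (c • f)
    rw [habs, map_smul, map_smul] at h2
    filter_upwards [h2, Lp.coeFn_smul c (S f),
      Lp.coeFn_smul ((‖c‖ : ℝ) : 𝕜) (S (absLp f))] with x h3 h4 h5
    rwa [h4, h5, Pi.smul_apply, Pi.smul_apply, smul_eq_mul, smul_eq_mul, RCLike.re_ofReal_mul] at h3
  have h2 := ae_all_iff.2 fun n => h1 (TopologicalSpace.denseSeq 𝕜 n)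
  filter_upwards [h2, hS.apply_absLp_nonneg f] with x hx hx0
  have hcl : IsClosed {c : 𝕜 | RCLike.re (c * S f x) ≤ ‖c‖ * RCLike.re (S (absLp f) x)} :=
    isClosed_le (RCLike.continuous_re.comp (continuous_id.mul continuous_const))
      (continuous_norm.mul continuous_const)
  have hall : ∀ c : 𝕜, RCLike.re (c * S f x) ≤ ‖c‖ * RCLike.re (S (absLp f) x) := fun c =>
    hcl.closure_subset_iff.2 (Set.range_subset_iff.2 hx)
      (TopologicalSpace.denseRange_denseSeq 𝕜 c)
  have h3 := hall (starRingEnd 𝕜 (S f x))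
  rw [RCLike.conj_mul, RCLike.norm_conj, ← RCLike.ofReal_pow, RCLike.ofReal_re, pow_two] at h3
  rcases (norm_nonneg (S f x)).eq_or_lt with h | h
  · rw [← h]
    exact hx0.1
  · exact le_of_mul_le_mul_left h3 h

end Positive

/-! ### Multiplication operators and the Miyadera integral on `L₁`. -/

section Multiplication

variable {Ω 𝕜 : Type*} [MeasurableSpace Ω] [RCLike 𝕜] {μ : Measure Ω}

theorem memLp_mul_of_bounded {W : Ω → ℝ} (hW : Measurable W) {c : ℝ} (hc : ∀ x, |W x| ≤ c)
    (f : Lp 𝕜 1 μ) : MemLp (fun x => (W x : 𝕜) * f x) 1 μ := by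
  refine MemLp.of_le_mul (c := c) (Lp.memLp f) ?_ (ae_of_all _ fun x => ?_)
  · exact (RCLike.continuous_ofReal.measurable.comp hW).aestronglyMeasurable.mul
      (Lp.aestronglyMeasurable f)
  · rw [norm_mul, RCLike.norm_ofReal]
    exact mul_le_mul_of_nonneg_right (hc x) (norm_nonneg _)

/-- Multiplication by a bounded measurable function as a bounded operator on `L₁(μ)`. -/
noncomputable def mulCLM (𝕜 : Type*) [RCLike 𝕜] (μ : Measure Ω) {W : Ω → ℝ} (hW : Measurable W)
    {c : ℝ} (hc : ∀ x, |W x| ≤ c) : Lp 𝕜 1 μ →L[𝕜] Lp 𝕜 1 μ :=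
  LinearMap.mkContinuous
    { toFun := fun f => (memLp_mul_of_bounded hW hc f).toLp
      map_add' := fun f g => by
        rw [← MemLp.toLp_add, MemLp.toLp_eq_toLp_iff]
        exact mul_coeFn_add_ae W _ _
      map_smul' := fun a f => by
        rw [RingHom.id_apply, ← MemLp.toLp_const_smul, MemLp.toLp_eq_toLp_iff]
        exact mul_coeFn_smul_ae W a _ } c fun f => by
    refine Lp.norm_le_mul_norm_of_ae_le_mul ?_
    filter_upwards [(memLp_mul_of_bounded hW hc f).coeFn_toLp] with x hx
    simp only [LinearMap.coe_mk, AddHom.coe_mk]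
    rw [hx, norm_mul, RCLike.norm_ofReal]
    exact mul_le_mul_of_nonneg_right (hc x) (norm_nonneg _)

theorem coeFn_mulCLM {W : Ω → ℝ} (hW : Measurable W) {c : ℝ} (hc : ∀ x, |W x| ≤ c)
    (f : Lp 𝕜 1 μ) : mulCLM 𝕜 μ hW hc f =ᵐ[μ] fun x => (W x : 𝕜) * f x :=
  (memLp_mul_of_bounded hW hc f).coeFn_toLp

theorem norm_mulCLM {W : Ω → ℝ} (hW : Measurable W) {c : ℝ} (hc : ∀ x, |W x| ≤ c)
    (f : Lp 𝕜 1 μ) : ‖mulCLM 𝕜 μ hW hc f‖ = ∫ x, |W x| * ‖f x‖ ∂μ := by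
  rw [L1.norm_eq_integral_norm]
  refine integral_congr_ae ?_
  filter_upwards [coeFn_mulCLM hW hc f] with x hx
  rw [hx, norm_mul, RCLike.norm_ofReal]

theorem integrable_abs_mul_norm {W : Ω → ℝ} {f : Lp 𝕜 1 μ}
    (h : MemLp (fun x => (W x : 𝕜) * f x) 1 μ) : Integrable (fun x => |W x| * ‖f x‖) μ := by
  refine (memLp_one_iff_integrable.1 h).norm.congr (ae_of_all _ fun x => ?_)
  simp only [norm_mul, RCLike.norm_ofReal]

theorem integrable_mul_re {W : Ω → ℝ} {f : Lp 𝕜 1 μ}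
    (h : MemLp (fun x => (W x : 𝕜) * f x) 1 μ) : Integrable (fun x => W x * RCLike.re (f x)) μ := by
  refine (memLp_one_iff_integrable.1 h).re.congr (ae_of_all _ fun x => ?_)
  simp only [RCLike.re_ofReal_mul]

theorem mulCLM_sub {W W' : Ω → ℝ} (hW : Measurable W) (hW' : Measurable W') {c c' c'' : ℝ}
    (hc : ∀ x, |W x| ≤ c) (hc' : ∀ x, |W' x| ≤ c') (hc'' : ∀ x, |W x - W' x| ≤ c'') :
    mulCLM 𝕜 μ hW hc - mulCLM 𝕜 μ hW' hc' = mulCLM 𝕜 μ (hW.sub hW') hc'' := by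
  ext1 f
  refine Lp.ext ?_
  rw [_root_.sub_apply]
  filter_upwards [coeFn_mulCLM hW hc f, coeFn_mulCLM hW' hc' f, coeFn_mulCLM (hW.sub hW') hc'' f,
    Lp.coeFn_sub (mulCLM 𝕜 μ hW hc f) (mulCLM 𝕜 μ hW' hc' f)] with x h1 h2 h3 h4
  rw [h4, Pi.sub_apply, h1, h2, h3, Pi.sub_apply, RCLike.ofReal_sub, sub_mul]

variable {T : ℝ≥0 → Lp 𝕜 1 μ →L[𝕜] Lp 𝕜 1 μ}

/-- On positive functions the weighted `L₁` norm is a linear functional and so commutes with the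
time integral. Allowing `τ ≥ t` permits `τ → ∞` later. -/
theorem miyaderaIntegral_mulCLM_le (hT : IsC0Semigroup T) (hpos : ∀ t, IsPositiveOperator (T t))
    (lam : ℝ) {W : Ω → ℝ} (hW : Measurable W) {c : ℝ} (hc : ∀ x, |W x| ≤ c) {t τ : ℝ}
    (ht : 0 ≤ t) (hτ : t ≤ τ) (f : Lp 𝕜 1 μ) :
    miyaderaIntegral T lam (mulCLM 𝕜 μ hW hc) t f ≤ ‖mulCLM 𝕜 μ hW hc
      (∫ s in (0 : ℝ)..τ, ((Real.exp (-lam * s.toNNReal) : ℝ) : 𝕜) • T s.toNNReal (absLp f))‖ := by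
  have hWa : Measurable fun x => |W x| := hW.abs
  have hca : ∀ x, |(|W x|)| ≤ c := fun x => by rw [abs_abs]; exact hc x
  -- `φ g = ∫ |W| Re g` is linear over `ℝ`, lies below `‖W g‖`, and at `T(s)|f|` dominates `‖W T(s)
  -- f‖`.
  let φ : Lp 𝕜 1 μ →L[ℝ] ℝ :=
    RCLike.reCLM.comp ((L1.integralCLM).comp ((mulCLM 𝕜 μ hWa hca).restrictScalars ℝ))
  have hφ : ∀ g : Lp 𝕜 1 μ, φ g = ∫ x, |W x| * RCLike.re (g x) ∂μ := fun g => by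
    have h1 : φ g = RCLike.re (∫ x, mulCLM 𝕜 μ hWa hca g x ∂μ) := by
      rw [← L1.integral_eq_integral, L1.integral_eq]
      rfl
    rw [h1, ← integral_re (L1.integrable_coeFn _)]
    refine integral_congr_ae ?_
    filter_upwards [coeFn_mulCLM hWa hca g] with x hx
    rw [hx, RCLike.re_ofReal_mul]
  have hφn : ∀ g : Lp 𝕜 1 μ, φ g ≤ ‖mulCLM 𝕜 μ hW hc g‖ := fun g => by
    rw [hφ, norm_mulCLM]
    refine integral_mono (integrable_mul_re (memLp_mul_of_bounded hWa hca g))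
      (integrable_abs_mul_norm (memLp_mul_of_bounded hW hc g)) fun x => ?_
    exact mul_le_mul_of_nonneg_left (RCLike.re_le_norm _) (abs_nonneg _)
  have hφT : ∀ s, ‖mulCLM 𝕜 μ hW hc (T s f)‖ ≤ φ (T s (absLp f)) := fun s => by
    rw [hφ, norm_mulCLM]
    refine integral_mono_ae (integrable_abs_mul_norm (memLp_mul_of_bounded hW hc _))
      (integrable_mul_re (memLp_mul_of_bounded hWa hca _)) ?_
    filter_upwards [(hpos s).norm_apply_le f] with x hx
    exact mul_le_mul_of_nonneg_left hx (abs_nonneg _)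
  set u : ℝ → Lp 𝕜 1 μ := fun s =>
    ((Real.exp (-lam * s.toNNReal) : ℝ) : 𝕜) • T s.toNNReal (absLp f) with hu
  have huc : Continuous u :=
    ((hT.exp_smul (-lam)).continuous (absLp f)).comp continuous_real_toNNReal
  have hφu : ∀ s, φ (u s) = Real.exp (-lam * s.toNNReal) * φ (T s.toNNReal (absLp f)) := fun s => by
    rw [hu]
    simp only
    rw [← RCLike.real_smul_eq_coe_smul, map_smul, smul_eq_mul]
  have hφu0 : ∀ s, 0 ≤ φ (u s) := fun s => by
    rw [hφu]
    exact mul_nonneg (Real.exp_pos _).le ((norm_nonneg _).trans (hφT _))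
  calc miyaderaIntegral T lam (mulCLM 𝕜 μ hW hc) t f ≤ ∫ s in (0 : ℝ)..t, φ (u s) := by
        refine intervalIntegral.integral_mono_on ht
          ((hT.continuous_miyadera lam _ f).intervalIntegrable _ _)
          ((φ.continuous.comp huc).intervalIntegrable _ _) fun s hs => ?_
        rw [hφu, Real.coe_toNNReal _ hs.1]
        exact mul_le_mul_of_nonneg_left (hφT _) (Real.exp_pos _).le
    _ ≤ ∫ s in (0 : ℝ)..τ, φ (u s) :=
        intervalIntegral.integral_mono_interval le_rfl ht hτ (ae_of_all _ hφu0)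
          ((φ.continuous.comp huc).intervalIntegrable _ _)
    _ = φ (∫ s in (0 : ℝ)..τ, u s) :=
        φ.intervalIntegral_comp_comm (huc.intervalIntegrable _ _)
    _ ≤ _ := hφn _

theorem eLpNorm_le_of_mulCompNorm_le {V : Ω → ℝ} {R : Lp 𝕜 1 μ →ₗ.[𝕜] Lp 𝕜 1 μ} {α : ℝ}
    (h : mulCompNorm V R ≤ ENNReal.ofReal α) (y : R.domain) :
    eLpNorm (fun x => (V x : 𝕜) * R y x) 1 μ ≤ ENNReal.ofReal (α * ‖(y : Lp 𝕜 1 μ)‖) := by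
  rcases (norm_nonneg (y : Lp 𝕜 1 μ)).eq_or_lt with h0 | h0
  · have hy : y = 0 := Subtype.ext (norm_eq_zero.1 h0.symm)
    rw [hy, LinearPMap.map_zero, eLpNorm_congr_ae (mul_coeFn_zero_ae V), eLpNorm_zero]
    exact zero_le
  · set r : ℝ := ‖(y : Lp 𝕜 1 μ)‖ with hr
    have h1 : ‖(((((r⁻¹ : ℝ) : 𝕜) • y : R.domain)) : Lp 𝕜 1 μ)‖ ≤ 1 := by
      rw [Submodule.coe_smul, norm_smul, RCLike.norm_ofReal, abs_of_pos (inv_pos.2 h0), ← hr,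
        inv_mul_cancel₀ h0.ne']
    have h2 := (le_iSup₂ (f := fun (f : R.domain) (_ : ‖(f : Lp 𝕜 1 μ)‖ ≤ 1) =>
      eLpNorm (fun x => (V x : 𝕜) * R f x) 1 μ) _ h1).trans h
    have h3 : y = ((r : ℝ) : 𝕜) • ((((r⁻¹ : ℝ) : 𝕜) • y : R.domain)) := by
      rw [smul_smul, ← RCLike.ofReal_mul, mul_inv_cancel₀ h0.ne', RCLike.ofReal_one, one_smul]
    conv_lhs => rw [h3]
    rw [LinearPMap.map_smul, eLpNorm_congr_ae (mul_coeFn_smul_ae V _ _), eLpNorm_const_smul,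
      mul_comm α, ENNReal.ofReal_mul h0.le]
    gcongr
    rw [← ofReal_norm, RCLike.norm_ofReal, abs_of_pos h0]

theorem mulCompNorm_mono {V W : Ω → ℝ} (h : ∀ x, |W x| ≤ |V x|)
    (R : Lp 𝕜 1 μ →ₗ.[𝕜] Lp 𝕜 1 μ) : mulCompNorm W R ≤ mulCompNorm V R := by
  refine iSup₂_mono fun f _ => eLpNorm_mono fun x => ?_
  rw [norm_mul, norm_mul, RCLike.norm_ofReal, RCLike.norm_ofReal]
  exact mul_le_mul_of_nonneg_right (h x) (norm_nonneg _)

end Multiplication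

/-! ### Truncations of a real function. -/

section Truncation

variable {Ω : Type*} (V : Ω → ℝ)

theorem measurable_truncation [MeasurableSpace Ω] {V : Ω → ℝ} (hV : Measurable V) (n : ℕ) :
    Measurable (truncation V n) :=
  (hV.min measurable_const).max measurable_const

theorem abs_truncation_le (n : ℕ) (x : Ω) : |truncation V n x| ≤ n := by
  have hn : (0 : ℝ) ≤ n := n.cast_nonneg
  refine abs_le.2 ⟨le_max_right _ _, max_le (min_le_right _ _) ?_⟩
  linarith

theorem abs_truncation_le_abs (n : ℕ) (x : Ω) : |truncation V n x| ≤ |V x| := by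
  have hn : (0 : ℝ) ≤ n := n.cast_nonneg
  have h1 := neg_abs_le (V x)
  have h2 := le_abs_self (V x)
  have h3 := abs_nonneg (V x)
  refine abs_le.2 ⟨?_, max_le ((min_le_left _ _).trans h2) (by linarith)⟩
  rcases le_total (V x) n with h | h
  · exact h1.trans (by rw [truncation, min_eq_left h]; exact le_max_left _ _)
  · exact (by linarith : -|V x| ≤ n).trans (by rw [truncation, min_eq_right h]; exact le_max_left _ _)

theorem truncation_eq_self {n : ℕ} {x : Ω} (h : |V x| ≤ n) : truncation V n x = V x := by
  rw [abs_le] at h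
  rw [truncation, min_eq_left h.2, max_eq_left h.1]

/-- The right side does not depend on `n`, so one choice of `N` controls the Miyadera integrals for
all `n ≥ N`. -/
theorem abs_truncation_sub_le {N n : ℕ} (h : N ≤ n) (x : Ω) :
    |truncation V n x - truncation V N x| ≤ |V x - truncation V N x| := by
  have hN : (0 : ℝ) ≤ N := N.cast_nonneg
  have hn : (N : ℝ) ≤ n := Nat.cast_le.2 h
  rcases le_or_gt |V x| n with h1 | h1
  · rw [truncation_eq_self V h1]
  · rcases lt_abs.1 h1 with h2 | h2
    · rw [truncation, truncation, min_eq_right h2.le, min_eq_right (hn.trans h2.le),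
        max_eq_left (by linarith), max_eq_left (by linarith)]
      exact abs_le_abs_of_nonneg (by linarith) (by linarith)
    · rw [truncation, truncation, min_eq_left (by linarith), min_eq_left (by linarith),
        max_eq_right (by linarith), max_eq_right (by linarith)]
      exact abs_le_abs_of_nonpos (by linarith) (by linarith)

theorem abs_sub_truncation_le (n : ℕ) (x : Ω) : |V x - truncation V n x| ≤ |V x| := by
  have hn : (0 : ℝ) ≤ n := n.cast_nonneg
  rcases le_total 0 (V x) with h | h
  · have h1 : truncation V n x ≤ V x :=
      max_le (min_le_left _ _) (by linarith)
    have h2 : 0 ≤ truncation V n x := (le_min h hn).trans (le_max_left _ _)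
    rw [abs_of_nonneg h, abs_of_nonneg (sub_nonneg.2 h1)]
    linarith
  · have h1 : V x ≤ truncation V n x := (le_min le_rfl (h.trans hn)).trans (le_max_left _ _)
    have h2 : truncation V n x ≤ 0 := max_le ((min_le_left _ _).trans h) (by linarith)
    rw [abs_of_nonpos h, abs_of_nonpos (sub_nonpos.2 h1)]
    linarith

end Truncation

/-! ### Absorption semigroups. -/

section Absorption

variable {Ω 𝕜 : Type*} [MeasurableSpace Ω] [RCLike 𝕜] {μ : Measure Ω}
  {T S : ℝ≥0 → Lp 𝕜 1 μ →L[𝕜] Lp 𝕜 1 μ}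

theorem SolvesDuhamel.isBoundedPerturbation {W : Ω → ℝ} (hW : Measurable W) {c : ℝ}
    (hc : ∀ x, |W x| ≤ c) (hc' : ∀ x, |(-W) x| ≤ c)
    (h : SolvesDuhamel T (mulCLM 𝕜 μ hW.neg hc') S) (hT : IsC0Semigroup T) (hS : IsC0Semigroup S)
    {M ω : ℝ} (hb : ∀ t : ℝ≥0, ‖T t‖ ≤ M * Real.exp (ω * t)) : IsBoundedPerturbation T W S := by
  have hmul : ∀ f : (multiplicationOperator 𝕜 μ W).domain,
      multiplicationOperator 𝕜 μ W f = -mulCLM 𝕜 μ hW.neg hc' f := fun f => by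
    refine Lp.ext ?_
    filter_upwards [(memLp_of_mem_multiplicationDomain f.2).coeFn_toLp,
      coeFn_mulCLM hW.neg hc' (f : Lp 𝕜 1 μ), Lp.coeFn_neg (mulCLM 𝕜 μ hW.neg hc' (f : Lp 𝕜 1 μ))]
      with x h1 h2 h3
    rw [h3, Pi.neg_apply, h2, Pi.neg_apply, RCLike.ofReal_neg, neg_mul, neg_neg]
    exact h1
  have hdom : ∀ f : Lp 𝕜 1 μ, f ∈ (multiplicationOperator 𝕜 μ W).domain := fun f =>
    memLp_mul_of_bounded hW hc f
  have hiff : ∀ f g, HasOrbitDeriv S f g ↔ HasOrbitDeriv T f (g - mulCLM 𝕜 μ hW.neg hc' f) :=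
    fun f g => by rw [← h.hasOrbitDeriv_iff hT hS hb, sub_add_cancel]
  refine ⟨hS, LinearPMap.ext ?_ ?_⟩
  · ext f
    rw [LinearPMap.sub_domain, Submodule.mem_inf, mem_semigroupGenerator_domain,
      mem_semigroupGenerator_domain]
    constructor
    · rintro ⟨g, hg⟩
      exact ⟨⟨_, (hiff f g).1 hg⟩, hdom f⟩
    · rintro ⟨⟨g, hg⟩, -⟩
      exact ⟨_, (h.hasOrbitDeriv_iff hT hS hb).2 hg⟩
  · intro f hf hf'
    rw [LinearPMap.sub_apply, hmul]
    have h1 := (hiff f _).1 (hasOrbitDeriv_semigroupGenerator ⟨f, hf⟩)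
    rw [h1.semigroupGenerator_eq]
    simp

theorem exists_isAbsorptionSemigroup (hT : IsC0Semigroup T)
    (hpos : ∀ t, IsPositiveOperator (T t)) {M ω : ℝ}
    (hb : ∀ t : ℝ≥0, ‖T t‖ ≤ M * Real.exp (ω * t)) {V : Ω → ℝ} (hV : Measurable V) {lam α : ℝ}
    (hlam : ω < lam) (hα0 : 0 ≤ α) (hα1 : α < 1)
    (h : mulCompNorm V (resolventOperator (semigroupGenerator T) (lam : 𝕜)) ≤ ENNReal.ofReal α) :
    ∃ U, IsAbsorptionSemigroup T V U ∧
      ∀ t : ℝ≥0, ‖U t‖ ≤ M / (1 - α) * Real.exp (lam * t) := by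
  have hM : 0 ≤ M := nonneg_of_norm_le_mul_exp hb
  have hVm : ∀ n, Measurable (truncation V n) := measurable_truncation hV
  have hVn : ∀ (n : ℕ) x, |(-truncation V n) x| ≤ n := fun n x => by
    rw [Pi.neg_apply, abs_neg]
    exact abs_truncation_le V n x
  -- The minus sign reflects that the generator is `A - V_n`.
  set B : ℕ → Lp 𝕜 1 μ →L[𝕜] Lp 𝕜 1 μ := fun n => mulCLM 𝕜 μ (hVm n).neg (hVn n) with hBdef
  choose S hS0 hCκ hSd using fun n => exists_solvesDuhamel hT hb (B n)
  choose C κ hS using hCκ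
  have hd := fun n => (hSd n).eq_add_integral hT (hS0 n) hb (hS n)
  set F : ℝ≥0 → Lp 𝕜 1 μ → Lp 𝕜 1 μ := fun τ f =>
    ∫ s in (0 : ℝ)..τ, ((Real.exp (-lam * s.toNNReal) : ℝ) : 𝕜) • T s.toNNReal (absLp f) with hF
  have hVF : ∀ τ f, eLpNorm (fun x => (V x : 𝕜) * F τ f x) 1 μ ≤
      ENNReal.ofReal (α * ((1 + M * Real.exp ((ω - lam) * τ)) * ‖f‖)) := fun τ f => by
    obtain ⟨y, hy, hy'⟩ := exists_resolventOperator_eq_integral hT hb hlam τ (absLp f)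
    have h1 := eLpNorm_le_of_mulCompNorm_le h y
    rw [hy'] at h1
    rw [norm_absLp] at hy
    exact h1.trans (ENNReal.ofReal_le_ofReal (mul_le_mul_of_nonneg_left hy hα0))
  have hVFm : ∀ τ f, MemLp (fun x => (V x : 𝕜) * F τ f x) 1 μ := fun τ f =>
    ⟨(RCLike.continuous_ofReal.measurable.comp hV).aestronglyMeasurable.mul
      (Lp.aestronglyMeasurable _), (hVF τ f).trans_lt ENNReal.ofReal_lt_top⟩
  have hB : ∀ n (t : ℝ≥0) (f : Lp 𝕜 1 μ), miyaderaIntegral T lam (B n) t f ≤ α * ‖f‖ := by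
    intro n t f
    -- At `τ = t` there is an excess factor `1 + M e^{(ω-λ)t}`, possibly making the constant exceed
    -- 1; it tends to 1 as `τ → ∞` with `t` fixed.
    have h1 : ∀ τ : ℝ≥0, t ≤ τ → miyaderaIntegral T lam (B n) t f ≤
        α * ((1 + M * Real.exp ((ω - lam) * τ)) * ‖f‖) := fun τ hτ => by
      refine (miyaderaIntegral_mulCLM_le hT hpos lam (hVm n).neg (hVn n) t.coe_nonneg
        (NNReal.coe_le_coe.2 hτ) f).trans ?_
      rw [← ENNReal.ofReal_le_ofReal_iff (by positivity), ofReal_norm, Lp.enorm_def,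
        eLpNorm_congr_ae (coeFn_mulCLM _ _ _)]
      refine (eLpNorm_mono fun x => ?_).trans (hVF τ f)
      rw [norm_mul, norm_mul, RCLike.norm_ofReal, RCLike.norm_ofReal, Pi.neg_apply, abs_neg]
      exact mul_le_mul_of_nonneg_right (abs_truncation_le_abs V n x) (norm_nonneg _)
    have h2 : Tendsto (fun τ : ℝ≥0 => α * ((1 + M * Real.exp ((ω - lam) * τ)) * ‖f‖)) atTop
        (𝓝 (α * ((1 + M * 0) * ‖f‖))) := by
      refine ((((Real.tendsto_exp_atBot.comp ?_).const_mul M).const_add 1).mul_const _).const_mul α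
      exact (NNReal.tendsto_coe_atTop.2 tendsto_id).const_mul_atTop_of_neg (sub_neg.2 hlam)
    rw [mul_zero, add_zero, one_mul] at h2
    exact ge_of_tendsto h2 ((eventually_ge_atTop t).mono h1)
  have hB' : ∀ (t : ℝ≥0) (f : Lp 𝕜 1 μ) (ε : ℝ), 0 < ε →
      ∃ N, ∀ n ≥ N, miyaderaIntegral T lam (B n - B N) t f ≤ ε := by
    intro t f ε hε
    -- This is the dominating function: the resolvent bound puts `V F` in `L₁`, and the truncations
    -- are eventually equal to `V` at each point.
    have hVi : Integrable (fun x => |V x| * ‖F t f x‖) μ := integrable_abs_mul_norm (hVFm t f)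
    have hmeas : ∀ n, AEStronglyMeasurable (fun x => |V x - truncation V n x| * ‖F t f x‖) μ :=
      fun n => (hV.sub (hVm n)).abs.aestronglyMeasurable.mul (Lp.aestronglyMeasurable _).norm
    have hle : ∀ n x, ‖|V x - truncation V n x| * ‖F t f x‖‖ ≤ |V x| * ‖F t f x‖ := fun n x => by
      rw [Real.norm_of_nonneg (by positivity)]
      exact mul_le_mul_of_nonneg_right (abs_sub_truncation_le V n x) (norm_nonneg _)
    have hlim : Tendsto (fun n => ∫ x, |V x - truncation V n x| * ‖F t f x‖ ∂μ) atTop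
        (𝓝 (∫ _, (0 : ℝ) ∂μ)) := by
      refine tendsto_integral_of_dominated_convergence _ hmeas hVi
        (fun n => ae_of_all _ (hle n)) (ae_of_all _ fun x => ?_)
      refine tendsto_const_nhds.congr' ?_
      obtain ⟨k, hk⟩ := exists_nat_ge |V x|
      filter_upwards [eventually_ge_atTop k] with n hn
      rw [truncation_eq_self V (hk.trans (Nat.cast_le.2 hn)), sub_self, abs_zero, zero_mul]
    rw [integral_zero] at hlim
    obtain ⟨N, hN⟩ := (hlim.eventually_lt_const hε).exists
    refine ⟨N, fun n hn => ?_⟩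
    have hc : ∀ x, |(-truncation V n) x - (-truncation V N) x| ≤ n + N := fun x =>
      (abs_sub _ _).trans (add_le_add (hVn n x) (hVn N x))
    have h1 := miyaderaIntegral_mulCLM_le hT hpos lam ((hVm n).neg.sub (hVm N).neg) hc t.coe_nonneg
      le_rfl f
    rw [norm_mulCLM] at h1
    rw [hBdef]
    simp only
    rw [mulCLM_sub _ _ _ _ hc]
    refine h1.trans ((integral_mono_of_nonneg (ae_of_all _ fun x => by positivity)
      (hVi.mono' (hmeas N) (ae_of_all _ (hle N))) (ae_of_all _ fun x => ?_)).trans hN.le)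
    refine mul_le_mul_of_nonneg_right ?_ (norm_nonneg _)
    rw [Pi.sub_apply, Pi.neg_apply, Pi.neg_apply, neg_sub_neg, abs_sub_comm]
    exact abs_truncation_sub_le V hn x
  have hSn : ∀ n (t : ℝ≥0), ‖S n t‖ ≤ M / (1 - α) * Real.exp (lam * t) := fun n =>
    norm_le_of_miyaderaIntegral_le hT hb hlam.le hα0 hα1 (hS n) (hd n) (hB n)
  obtain ⟨U, hU0, hU, hUn⟩ := exists_tendsto_isC0Semigroup hT hα0 hα1 hS0 hSn hd hB hB'
  exact ⟨U, ⟨hU0, S, fun n => (hSd n).isBoundedPerturbation (hVm n) (abs_truncation_le V n) (hVn n)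
    hT (hS0 n) hb, hU⟩, hUn⟩

end Absorption

/-! ### The theorem for `V` and its positive and negative parts. -/

theorem mainTheorem9 {Ω 𝕜 : Type*} [MeasurableSpace Ω] [RCLike 𝕜] (μ : Measure Ω)
    (T : ℝ≥0 → Lp 𝕜 1 μ →L[𝕜] Lp 𝕜 1 μ) (hT : IsC0Semigroup T)
    (hT_pos : ∀ t, IsPositiveOperator (T t))
    (M ω : ℝ) (hM : 1 ≤ M) (hT_bound : ∀ t : ℝ≥0, ‖T t‖ ≤ M * Real.exp (ω * t))
    (V : Ω → ℝ) (hV : Measurable V)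
    (lam α : ℝ) (hlam : ω < lam) (hα_pos : 0 < α) (hα_lt : α < 1)
    (hV_small : mulCompNorm V (resolventOperator (semigroupGenerator T) (lam : 𝕜)) ≤
      ENNReal.ofReal α) :
    IsAdmissible T V ∧
    ∃ TV : ℝ≥0 → Lp 𝕜 1 μ →L[𝕜] Lp 𝕜 1 μ, IsAbsorptionSemigroup T V TV ∧
      ∀ t : ℝ≥0, ‖TV t‖ ≤ M / (1 - α) * Real.exp (lam * t) := by
  have key : ∀ W : Ω → ℝ, Measurable W → (∀ x, |W x| ≤ |V x|) →
      ∃ U, IsAbsorptionSemigroup T W U ∧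
        ∀ t : ℝ≥0, ‖U t‖ ≤ M / (1 - α) * Real.exp (lam * t) := fun W hW hWV =>
    exists_isAbsorptionSemigroup hT hT_pos hT_bound hW hlam hα_pos.le hα_lt
      ((mulCompNorm_mono hWV _).trans hV_small)
  obtain ⟨U₁, h₁, -⟩ := key (fun x => max (V x) 0) (hV.max measurable_const) fun x => by
    simpa using abs_max_sub_max_le_abs (V x) 0 0
  obtain ⟨U₂, h₂, -⟩ := key (fun x => min (V x) 0) (hV.min measurable_const) fun x => by
    simpa using abs_min_sub_min_le_max (V x) 0 0 0
  exact ⟨⟨⟨U₁, h₁⟩, ⟨U₂, h₂⟩⟩, key V hV fun x => le_rfl⟩
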